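/- Let $n\ge 0$ be an integer and let $A$ be a complex symmetric $n\times n$ matrix with operator norm $\|A\|<1$. For $z,w\in\mathbb C^n$ write $z\cdot w=\sum_i z_iw_i$ and $|z|^2=\sum_i|z_i|^2$; let $d\mu(w)=\pi^{-n}e^{-|w|^2}\,d\lambda(w)$, with $\lambda$ Lebesgue measure on $\mathbb C^n$, be the measure of the Bargmann–Fock space $\mathscr F_n$. For $S=\begin{bmatrix}\lambda&\mu\\ \bar\mu&\bar\lambda\end{bmatrix}$ in the complex realization of the real symplectic group, let $U_S$ be the metaplectic operator on $\mathscr F_n$ with kernel (with respect to $\mu$) $$U_S(z,w)=(\det\lambda)^{-1/2}\exp\{\tfrac12 z\cdot\bar\mu\lambda^{-1}z-\tfrac12\bar w\cdot\lambda^{-1}\mu\bar w+z\cdot(\lambda^{-1})^{T}\bar w\}.$$ The squeezed state with parameter $A$ is $e_A=U_{\iota(A)}\mathbf 1\in\mathscr F_n$, where $$\iota(A)=\begin{bmatrix}\Lambda&A^*\bar\Lambda\\ A\Lambda&\bar\Lambda\end{bmatrix},\qquad \Lambda=(I-A^*A)^{-1/2},\quad \bar\Lambda=(I-AA^*)^{-1/2}.$$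 Its Schrödinger wave function is its inverse Bargmann transform $$\psi_A(x)=\pi^{-n/4}e^{-x\cdot x/2}\int e^{-\bar z\cdot\bar z/2+\sqrt2\,\bar z\cdot x}\,e_A(z)\,d\mu(z),\qquad x\in\mathbb R^n.$$ For $q,p\in\mathbb R^n$ and $z=q+ip$, let $W_{e_A}(z)=\pi^{-n}(\tilde T(z)\psi_A,\psi_A)_{L^2(\mathbb R^n)}$ be the Wigner distribution, where $(\tilde T(q+ip)\psi)(x)=e^{2ip\cdot(x-q)}\psi(2q-x)$ is the Grossmann–Royer operator $\hat T(z)\tilde T(0)\hat T(-z)$, with $(\hat T(q+ip)\psi)(x)=e^{i(p\cdot x-\frac12p\cdot q)}\psi(x-q)$ and $(\tilde T(0)\psi)(x)=\psi(-x)$. Then: 1. For all $z=q+ip$, $$W_{e_A}(z)=\pi^{-n}e^{-|z'|^2},\qquad z'=(I-A\bar A)^{-1/2}(z-A\bar z).$$ 2. There are a unitary matrix $U$ and a real nonnegative diagonal matrix $\Sigma=\mathrm{diag}(\sigma_1,\dots,\sigma_n)$ with $A=U\Sigma U^T$. 3. For every such $U$ and $\Sigma$ one has $\sigma_i<1$ for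 all $i$. Put $$a=\sqrt{\tfrac{I+\Sigma}{I-\Sigma}},\quad b=\sqrt{\tfrac{I-\Sigma}{I+\Sigma}},\quad Q=\begin{bmatrix}\Re U&-\Im U\\ \Im U&\Re U\end{bmatrix},\quad D=\begin{bmatrix}b&0\\0&a\end{bmatrix}.$$ Then $a$ is positive, $b=a^{-1}$, $Q$ is orthogonal and symplectic, $D$ is symplectic, and for all $q,p\in\mathbb R^n$, identifying vectors of $\mathbb C^n$ with the pairs of their real and imaginary parts, $$z'=QDQ^{-1}z ,\qquad W_{e_A}(z)=\pi^{-n}\exp\Big\{-\sum_{i=1}^n\Big(\frac{\tilde q_i^2}{a_i^2}+\frac{\tilde p_i^2}{b_i^2}\Big)\Big\},\qquad \begin{bmatrix}\tilde q\\ \tilde p\end{bmatrix}=Q^T\begin{bmatrix}q\\ p\end{bmatrix}.$$ Thus the squeezing map $z\mapsto z'$ is a diagonal squeezing $D$ in the phase-space variables rotated by the orthogonal symplectic matrix $Q$. -/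

import Mathlib

open MeasureTheory
open scoped Matrix Real

noncomputable section

namespace Squeezed

/-! Phase space `ℝⁿ × ℝⁿ` is identified with `ℂⁿ` through `z = q + i p`.  On `ℂⁿ` the product
`z ⬝ᵥ w = ∑ zᵢ wᵢ` is bilinear, and the conjugate of a vector is `star z`. -/

/-- The entrywise complex conjugate of a matrix. -/
def conjM {n : ℕ} (A : Matrix (Fin n) (Fin n) ℂ) : Matrix (Fin n) (Fin n) ℂ :=
  A.map (starRingEnd ℂ)

/-- The domain `𝒟ₙ`: complex symmetric matrices of (Euclidean) operator norm less than `1`. -/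
def domain (n : ℕ) : Set (Matrix (Fin n) (Fin n) ℂ) :=
  {A | Aᵀ = A ∧ ‖Matrix.toEuclideanCLM (n := Fin n) (𝕜 := ℂ) A‖ < 1}

/-- `M^{-1/2}` for a positive definite Hermitian matrix `M`, by functional calculus. -/
def invSqrt {n : ℕ} (M : Matrix (Fin n) (Fin n) ℂ) : Matrix (Fin n) (Fin n) ℂ :=
  cfc (fun x : ℝ => (Real.sqrt x)⁻¹) M

/-- The embedding of `𝒟ₙ` into the complex realization of the real symplectic group. -/
def iota {n : ℕ} (A : Matrix (Fin n) (Fin n) ℂ) :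
    Matrix (Fin n ⊕ Fin n) (Fin n ⊕ Fin n) ℂ :=
  Matrix.fromBlocks (invSqrt (1 - Aᴴ * A)) (Aᴴ * invSqrt (1 - A * Aᴴ))
    (A * invSqrt (1 - Aᴴ * A)) (invSqrt (1 - A * Aᴴ))

/-- The measure `π⁻ⁿ exp(-|z|²) dλ(z)` of the Bargmann-Fock space. -/
def fockMeasure (n : ℕ) : Measure (Fin n → ℂ) :=
  volume.withDensity
    (fun z => ENNReal.ofReal ((π ^ n)⁻¹ * Real.exp (-∑ i, ‖z i‖ ^ 2)))

/-- The kernel `U_S(z,w)` of the metaplectic representation in the Bargmann-Fock space, for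
`S = [[λ, μ], [μ̄, λ̄]]`.  The square root is the principal one. -/
def metaplecticKernel {n : ℕ} (S : Matrix (Fin n ⊕ Fin n) (Fin n ⊕ Fin n) ℂ)
    (z w : Fin n → ℂ) : ℂ :=
  S.toBlocks₁₁.det ^ (-(1 / 2) : ℂ) *
    Complex.exp ((1 / 2) * (z ⬝ᵥ ((S.toBlocks₂₁ * S.toBlocks₁₁⁻¹) *ᵥ z))
      - (1 / 2) * (star w ⬝ᵥ ((S.toBlocks₁₁⁻¹ * S.toBlocks₁₂) *ᵥ star w))
      + z ⬝ᵥ ((S.toBlocks₁₁⁻¹)ᵀ *ᵥ star w))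

/-- The operator `U_S` with kernel `U_S(z,w)`. -/
def metaplectic {n : ℕ} (S : Matrix (Fin n ⊕ Fin n) (Fin n ⊕ Fin n) ℂ)
    (F : (Fin n → ℂ) → ℂ) (z : Fin n → ℂ) : ℂ :=
  ∫ w, metaplecticKernel S z w * F w ∂(fockMeasure n)

/-- The squeezed state `e_A = U_{ι(A)} 𝟏`, an element of the Bargmann-Fock space. -/
def squeezedState {n : ℕ} (A : Matrix (Fin n) (Fin n) ℂ) : (Fin n → ℂ) → ℂ :=
  metaplectic (iota A) (fun _ => 1)

/-- The inverse Bargmann transform: the Schrödinger wave function of a Bargmann-Fock state. -/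
def invBargmann {n : ℕ} (F : (Fin n → ℂ) → ℂ) (x : Fin n → ℝ) : ℂ :=
  ((π ^ (-(n : ℝ) / 4) * Real.exp (-(x ⬝ᵥ x) / 2) : ℝ) : ℂ) *
    ∫ z, Complex.exp (-(star z ⬝ᵥ star z) / 2 + (Real.sqrt 2 : ℂ) *
      (star z ⬝ᵥ (fun i => (x i : ℂ)))) * F z ∂(fockMeasure n)

/-- The Heisenberg-Weyl operator `T̂(q₀,p₀)` in the Schrödinger representation. -/
def heisenbergWeyl {n : ℕ} (q₀ p₀ : Fin n → ℝ) (ψ : (Fin n → ℝ) → ℂ) (x : Fin n → ℝ) : ℂ :=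
  Complex.exp (Complex.I * ((p₀ ⬝ᵥ x - (1 / 2) * (p₀ ⬝ᵥ q₀) : ℝ) : ℂ)) * ψ (x - q₀)

/-- The parity operator. -/
def parity {n : ℕ} (ψ : (Fin n → ℝ) → ℂ) (x : Fin n → ℝ) : ℂ := ψ (-x)

/-- The Grossmann-Royer operator `T̃(z₀) = T̂(z₀) T̃(0) T̂(-z₀)`. -/
def grossmannRoyer {n : ℕ} (q₀ p₀ : Fin n → ℝ) (ψ : (Fin n → ℝ) → ℂ) : (Fin n → ℝ) → ℂ :=
  heisenbergWeyl q₀ p₀ (parity (heisenbergWeyl (-q₀) (-p₀) ψ))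

/-- The Wigner distribution `Wψ(q,p) = π⁻ⁿ (T̃(q,p) ψ, ψ)_{L²}` of a wave function, that is,
`(2π)⁻ⁿ ∫ exp(-i p·y) ψ(q + y/2) conj(ψ(q - y/2)) dy`. -/
def wigner {n : ℕ} (ψ : (Fin n → ℝ) → ℂ) (q p : Fin n → ℝ) : ℂ :=
  (((π ^ n)⁻¹ : ℝ) : ℂ) * ∫ x, grossmannRoyer q p ψ x * star (ψ x)

/-- The Wigner distribution of a Bargmann-Fock state, through its Schrödinger wave function. -/
def wignerFock {n : ℕ} (F : (Fin n → ℂ) → ℂ) (q p : Fin n → ℝ) : ℂ :=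
  wigner (invBargmann F) q p

/-- `z = q + i p`. -/
def toComplex {n : ℕ} (q p : Fin n → ℝ) : Fin n → ℂ :=
  fun i => (q i : ℂ) + Complex.I * (p i : ℂ)

/-- The real vector `(Re z, Im z)` of length `2n`. -/
def toReal {n : ℕ} (z : Fin n → ℂ) : Fin n ⊕ Fin n → ℝ :=
  Sum.elim (fun i => (z i).re) (fun i => (z i).im)

/-- `z' = (I - A Ā)^{-1/2} (z - A z̄)`. -/
def zPrime {n : ℕ} (A : Matrix (Fin n) (Fin n) ℂ) (z : Fin n → ℂ) : Fin n → ℂ :=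
  invSqrt (1 - A * conjM A) *ᵥ (z - A *ᵥ star z)

/-- `A = U Σ Uᵀ` is a symmetric singular value decomposition: `U` is unitary and `Σ` is the
diagonal matrix with the real nonnegative entries `σ i`. -/
def IsSymmSVD {n : ℕ} (A U : Matrix (Fin n) (Fin n) ℂ) (σ : Fin n → ℝ) : Prop :=
  U ∈ Matrix.unitaryGroup (Fin n) ℂ ∧ (∀ i, 0 ≤ σ i) ∧
    A = U * Matrix.diagonal (fun i => (σ i : ℂ)) * Uᵀ

/-- The real matrix `Q = [[Re U, -Im U], [Im U, Re U]]`. -/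
def rotQ {n : ℕ} (U : Matrix (Fin n) (Fin n) ℂ) : Matrix (Fin n ⊕ Fin n) (Fin n ⊕ Fin n) ℝ :=
  Matrix.fromBlocks (U.map Complex.re) (-(U.map Complex.im))
    (U.map Complex.im) (U.map Complex.re)

/-- The semi-axes `a = √((I + Σ) / (I - Σ))`. -/
def axisA {n : ℕ} (σ : Fin n → ℝ) (i : Fin n) : ℝ := Real.sqrt ((1 + σ i) / (1 - σ i))

/-- The semi-axes `b = √((I - Σ) / (I + Σ))`. -/
def axisB {n : ℕ} (σ : Fin n → ℝ) (i : Fin n) : ℝ := Real.sqrt ((1 - σ i) / (1 + σ i))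

/-- The diagonal squeezing matrix `D = diag(√((I - Σ)/(I + Σ)), √((I + Σ)/(I - Σ)))`. -/
def squeezeD {n : ℕ} (σ : Fin n → ℝ) : Matrix (Fin n ⊕ Fin n) (Fin n ⊕ Fin n) ℝ :=
  Matrix.diagonal (Sum.elim (axisB σ) (axisA σ))

end Squeezed

end

namespace Squeezed

/-! Everything reduces to Gaussian integrals with complex symmetric quadratic forms whose real part
is positive definite. Such a form is brought to diagonal shape by a real change of variables
(`norm_sq_gaussInt`), and `exists_fock_gaussian` transfers the result to the Fock measure through
the coordinates `(z, z̄)`. Two applications show that `e_A` is a multiple of `exp(½ z·Az)` and that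
`ψ_A` is a multiple `κ` of `exp(-½ x·Bx)` with `B = (I - A)(I + A)⁻¹`.

The Wigner integral of this Gaussian is again Gaussian, with form `M = B + B̄ = 2(I + A)⁻¹(I - AĀ)(I
+ Ā)⁻¹`. Put `y = Bq + ip`. The exponent collapses to `-ȳ·(2M⁻¹)y`, and since `(I + A)y = z - Az̄`
this is `-|z'|²`. No branch of a square root of a determinant is ever followed: the Wigner
distribution sees only `|κ|²`, so moduli suffice, and the remaining Gaussian integral is real and
nonnegative because `M` is real.

The factorization `A = UΣUᵀ` comes from the real spectral theorem applied to the antilinear map `z ↦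
Az̄`. In the coordinates `ζ = U*z` the squeezing map is `ζ ↦ (I - Σ²)^{-1/2}(ζ - Σζ̄)`, which scales
real parts by `b` and imaginary parts by `a`. -/

/-! ### Gaussian integrals over real space with a complex quadratic form -/

theorem exists_orthogonal_diagonalization {ι : Type*} [Fintype ι] [DecidableEq ι]
    {H : Matrix ι ι ℝ} (hH : H.IsHermitian) :
    ∃ O : Matrix ι ι ℝ, Oᵀ * O = 1 ∧ Oᵀ * H * O = Matrix.diagonal hH.eigenvalues := by
  refine ⟨hH.eigenvectorUnitary, ?_, ?_⟩
  · have := Unitary.coe_star_mul_self hH.eigenvectorUnitary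
    rwa [Matrix.star_eq_conjTranspose, Matrix.conjTranspose_eq_transpose_of_trivial] at this
  · have := hH.conjStarAlgAut_star_eigenvectorUnitary
    rw [Unitary.conjStarAlgAut_star_apply, Matrix.star_eq_conjTranspose,
      Matrix.conjTranspose_eq_transpose_of_trivial] at this
    simpa using this

/-- Scaling an eigenbasis of `P` by the inverse square roots of the eigenvalues turns `P` into the
identity. An orthogonal diagonalization of the transformed `R` then leaves that identity unchanged.
-/
theorem exists_simultaneous_diagonalization {ι : Type*} [Fintype ι] [DecidableEq ι]
    {P R : Matrix ι ι ℝ} (hP : P.PosDef) (hR : R.IsHermitian) :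
    ∃ (S : Matrix ι ι ℝ) (r : ι → ℝ), S.det ≠ 0 ∧ Sᵀ * P * S = 1 ∧
      Sᵀ * R * S = Matrix.diagonal r := by
  obtain ⟨O, hO, hOP⟩ := exists_orthogonal_diagonalization hP.isHermitian
  set d := hP.isHermitian.eigenvalues
  have hd : ∀ i, 0 < d i := hP.eigenvalues_pos
  set T : Matrix ι ι ℝ := O * Matrix.diagonal fun i => (Real.sqrt (d i))⁻¹ with hT
  have hTP : Tᵀ * P * T = 1 := by
    have : Tᵀ * P * T = Matrix.diagonal (fun i => (Real.sqrt (d i))⁻¹) * (Oᵀ * P * O) *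
        Matrix.diagonal (fun i => (Real.sqrt (d i))⁻¹) := by
      simp only [hT, Matrix.transpose_mul, Matrix.diagonal_transpose, Matrix.mul_assoc]
    rw [this, hOP, Matrix.diagonal_mul_diagonal, Matrix.diagonal_mul_diagonal,
      ← Matrix.diagonal_one]
    congr 1
    ext i
    have h := Real.mul_self_sqrt (hd i).le
    have h' := (Real.sqrt_pos.2 (hd i)).ne'
    field_simp
    nlinarith
  have hTR : (Tᵀ * R * T).IsHermitian := by
    rw [Matrix.IsHermitian, Matrix.conjTranspose_eq_transpose_of_trivial] at hR ⊢
    simp only [Matrix.transpose_mul, Matrix.transpose_transpose, hR, Matrix.mul_assoc]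
  obtain ⟨O', hO', hOR⟩ := exists_orthogonal_diagonalization hTR
  have hS : (T * O')ᵀ * P * (T * O') = 1 := by
    calc (T * O')ᵀ * P * (T * O') = O'ᵀ * (Tᵀ * P * T) * O' := by
          simp only [Matrix.transpose_mul, Matrix.mul_assoc]
      _ = 1 := by rw [hTP, Matrix.mul_one, hO']
  refine ⟨T * O', hTR.eigenvalues, ?_, hS, ?_⟩
  · intro h
    have := congrArg Matrix.det hS
    rw [Matrix.det_mul, h, mul_zero, Matrix.det_one] at this
    exact zero_ne_one this
  · rw [← hOR]
    simp only [Matrix.transpose_mul, Matrix.mul_assoc]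

theorem integral_comp_mulVec {ι : Type*} [Fintype ι] [DecidableEq ι] {S : Matrix ι ι ℝ}
    (hS : S.det ≠ 0) (f : (ι → ℝ) → ℂ) :
    ∫ v, f v = ((|S.det| : ℝ) : ℂ) * ∫ v, f (S *ᵥ v) := by
  have hmap := Real.map_matrix_volume_pi_eq_smul_volume_pi hS
  have hemb : MeasurableEmbedding (Matrix.toLin' S) := by
    have h := (LinearEquiv.toContinuousLinearEquiv
      (Matrix.toLin'OfInv (S.nonsing_inv_mul hS.isUnit)
        (S.mul_nonsing_inv hS.isUnit))).toHomeomorph.measurableEmbedding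
    convert h using 1
    ext v
    rfl
  have := hemb.integral_map (μ := volume) f
  rw [hmap, integral_smul_measure] at this
  simp only [Matrix.toLin'_apply] at this
  rw [← this, ENNReal.toReal_ofReal (abs_nonneg _), abs_inv, Complex.real_smul, ← mul_assoc]
  have h0 : ((|S.det| : ℝ) : ℂ) ≠ 0 := by exact_mod_cast abs_ne_zero.2 hS
  push_cast
  rw [mul_inv_cancel₀ h0, one_mul]

/-- The vector of complex numbers with the given real entries. -/
def cvec {ι : Type*} (v : ι → ℝ) : ι → ℂ := fun i => (v i : ℂ)

/-- The Gaussian integral with quadratic form `M`. -/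
noncomputable def gaussInt {ι : Type*} [Fintype ι] (M : Matrix ι ι ℂ) : ℂ :=
  ∫ v : ι → ℝ, Complex.exp (-(1 / 2) * (cvec v ⬝ᵥ (M *ᵥ cvec v)))

theorem cvec_mulVec {ι : Type*} [Fintype ι] (S : Matrix ι ι ℝ) (v : ι → ℝ) :
    cvec (S *ᵥ v) = S.map Complex.ofReal *ᵥ cvec v := by
  ext i
  simp [cvec, Matrix.mulVec, dotProduct]

theorem dotProduct_mulVec_conj {ι R : Type*} [Fintype ι] [CommRing R] (S M : Matrix ι ι R)
    (v w : ι → R) : (S *ᵥ v) ⬝ᵥ (M *ᵥ (S *ᵥ w)) = v ⬝ᵥ ((Sᵀ * M * S) *ᵥ w) := by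
  rw [← Matrix.mulVec_mulVec, ← Matrix.mulVec_mulVec, Matrix.dotProduct_mulVec v,
    Matrix.vecMul_transpose]

/-- The real and imaginary parts of `M` are diagonalized together, giving entries `1 + i rⱼ`. The
matrix `S` is real, so it is a legitimate substitution in an integral over real vectors. -/
theorem exists_complex_diagonalization {ι : Type*} [Fintype ι] [DecidableEq ι]
    {M : Matrix ι ι ℂ} (hM : Mᵀ = M)
    (hpos : ∀ v : ι → ℝ, v ≠ 0 → 0 < (cvec v ⬝ᵥ (M *ᵥ cvec v)).re) :
    ∃ (S : Matrix ι ι ℝ) (b : ι → ℂ), S.det ≠ 0 ∧ (∀ i, 0 < (b i).re) ∧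
      (S.map Complex.ofReal)ᵀ * M * S.map Complex.ofReal = Matrix.diagonal b := by
  have hre : ∀ v : ι → ℝ, (cvec v ⬝ᵥ (M *ᵥ cvec v)).re = v ⬝ᵥ (M.map Complex.re *ᵥ v) := by
    intro v
    simp [cvec, dotProduct, Matrix.mulVec, Complex.re_sum]
  have hP : (M.map Complex.re).PosDef := by
    refine Matrix.PosDef.of_dotProduct_mulVec_pos ?_ ?_
    · rw [Matrix.IsHermitian, Matrix.conjTranspose_eq_transpose_of_trivial,
        ← Matrix.transpose_map, hM]
    · intro v hv
      rw [star_trivial, ← hre]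
      exact hpos v hv
  have hR : (M.map Complex.im).IsHermitian := by
    rw [Matrix.IsHermitian, Matrix.conjTranspose_eq_transpose_of_trivial,
        ← Matrix.transpose_map, hM]
  obtain ⟨S, r, hS, h1, h2⟩ := exists_simultaneous_diagonalization hP hR
  refine ⟨S, fun i => 1 + Complex.I * r i, hS, fun i => by simp, ?_⟩
  have hMd : M = (M.map Complex.re).map Complex.ofReal +
      Complex.I • (M.map Complex.im).map Complex.ofReal := by
    ext i j
    simp [mul_comm Complex.I, Complex.re_add_im]
  have hmap : ∀ X Y : Matrix ι ι ℝ, (X * Y).map Complex.ofReal =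
      X.map Complex.ofReal * Y.map Complex.ofReal := fun X Y =>
    Matrix.map_mul (f := Complex.ofRealHom)
  have h1' := congrArg (fun X : Matrix ι ι ℝ => X.map Complex.ofReal) h1
  have h2' := congrArg (fun X : Matrix ι ι ℝ => X.map Complex.ofReal) h2
  simp only [hmap] at h1' h2'
  rw [← Matrix.transpose_map, hMd, Matrix.mul_add, Matrix.add_mul, h1', Matrix.mul_smul,
    Matrix.smul_mul, h2']
  ext i j
  by_cases hij : i = j
  · subst hij; simp
  · simp [hij]

theorem norm_sq_gaussInt_diagonal {ι : Type*} [Fintype ι] [DecidableEq ι] {b : ι → ℂ}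
    (hb : ∀ i, 0 < (b i).re) :
    ‖gaussInt (Matrix.diagonal b)‖ ^ 2 = (2 * π) ^ Fintype.card ι / ‖∏ i, b i‖ ∧
    ∀ c : ι → ℂ, ∫ v : ι → ℝ, Complex.exp (-(1 / 2) *
      (cvec v ⬝ᵥ (Matrix.diagonal b *ᵥ cvec v)) + c ⬝ᵥ cvec v) =
      gaussInt (Matrix.diagonal b) * Complex.exp ((1 / 2) * ∑ i, c i ^ 2 / b i) := by
  have hb' : ∀ i, 0 < (b i / 2).re := fun i => by simpa using hb i
  have key := GaussianFourier.integral_cexp_neg_sum_mul_add hb'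
  have hq : ∀ v : ι → ℝ, -(1 / 2) * (cvec v ⬝ᵥ (Matrix.diagonal b *ᵥ cvec v)) =
      -∑ i, b i / 2 * (v i : ℂ) ^ 2 := by
    intro v
    simp only [dotProduct, Matrix.mulVec_diagonal, cvec, Finset.mul_sum, ← Finset.sum_neg_distrib]
    exact Finset.sum_congr rfl fun i _ => by ring
  have hG : gaussInt (Matrix.diagonal b) = ∏ i, ((π : ℂ) / (b i / 2)) ^ (1 / 2 : ℂ) := by
    have := key 0
    simp only [Pi.zero_apply, zero_mul, Finset.sum_const_zero, add_zero] at this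
    rw [gaussInt]
    simp only [hq, this]
    simp
  constructor
  · rw [hG, norm_prod, ← Finset.prod_pow, norm_prod, ← Finset.card_univ, ← Finset.prod_const,
      ← Finset.prod_div_distrib]
    refine Finset.prod_congr rfl fun i _ => ?_
    rw [← norm_pow, ← Complex.cpow_nat_mul]
    norm_num
    rw [abs_of_pos Real.pi_pos]
    field_simp
  · intro c
    have h := key c
    simp only [hq]
    simp only [dotProduct, cvec]
    rw [h, hG, Finset.prod_mul_distrib, ← Complex.exp_sum, Finset.mul_sum]
    congr 3
    ext i
    have : b i ≠ 0 := fun h0 => by simpa [h0] using hb i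
    field_simp
    ring

/-- Substituting `v = S v'` reduces both claims to the diagonal case: the Jacobian `|det S|` is
compensated by `det M · (det S)² = ∏ bᵢ`. Only the modulus is recorded, which avoids choosing a
branch of `(det M)^{-1/2}`. Writing the linear term as `M u` makes completing the square free of
`M⁻¹`. -/
theorem norm_sq_gaussInt {ι : Type*} [Fintype ι] [DecidableEq ι] {M : Matrix ι ι ℂ}
    (hM : Mᵀ = M) (hpos : ∀ v : ι → ℝ, v ≠ 0 → 0 < (cvec v ⬝ᵥ (M *ᵥ cvec v)).re) :
    ‖gaussInt M‖ ^ 2 = (2 * π) ^ Fintype.card ι / ‖M.det‖ ∧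
    ∀ u : ι → ℂ, ∫ v : ι → ℝ, Complex.exp (-(1 / 2) * (cvec v ⬝ᵥ (M *ᵥ cvec v)) +
        (M *ᵥ u) ⬝ᵥ cvec v) =
      gaussInt M * Complex.exp ((1 / 2) * (u ⬝ᵥ (M *ᵥ u))) := by
  obtain ⟨S, b, hS, hb, hSM⟩ := exists_complex_diagonalization hM hpos
  obtain ⟨h1, h2⟩ := norm_sq_gaussInt_diagonal hb
  set S' := S.map Complex.ofReal with hS'
  have hdet : S'.det = (S.det : ℂ) := (RingHom.map_det Complex.ofRealHom S).symm
  have hS'u : IsUnit S'.det := by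
    rw [hdet]
    exact (Complex.ofReal_ne_zero.2 hS).isUnit
  have hG : gaussInt M = ((|S.det| : ℝ) : ℂ) * gaussInt (Matrix.diagonal b) := by
    rw [gaussInt, integral_comp_mulVec hS, gaussInt]
    simp only [cvec_mulVec, ← hS', dotProduct_mulVec_conj, hSM]
  constructor
  · have hd := congrArg Matrix.det hSM
    rw [Matrix.det_mul, Matrix.det_mul, Matrix.det_transpose, Matrix.det_diagonal, hdet] at hd
    have hMd : ‖M.det‖ * |S.det| ^ 2 = ‖∏ i, b i‖ := by
      rw [← hd]
      simp only [norm_mul, Complex.norm_real, Real.norm_eq_abs]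
      ring
    have hb0 : ‖∏ i, b i‖ ≠ 0 := by
      rw [norm_ne_zero_iff, Finset.prod_ne_zero_iff]
      intro i _ h0
      simpa [h0] using hb i
    rw [hG, norm_mul, mul_pow, h1, ← hMd]
    rw [← hMd] at hb0
    have hM0 := left_ne_zero_of_mul hb0
    have hs0 := right_ne_zero_of_mul hb0
    simp only [Complex.norm_real, Real.norm_eq_abs, abs_abs]
    field_simp
  · intro u
    obtain ⟨t, rfl⟩ : ∃ t, u = S' *ᵥ t :=
      ⟨S'⁻¹ *ᵥ u, by rw [Matrix.mulVec_mulVec, Matrix.mul_nonsing_inv _ hS'u, Matrix.one_mulVec]⟩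
    rw [integral_comp_mulVec hS, hG, mul_assoc]
    congr 1
    have hlin : ∀ v : ι → ℝ, (M *ᵥ (S' *ᵥ t)) ⬝ᵥ (S' *ᵥ cvec v) =
        (Matrix.diagonal b *ᵥ t) ⬝ᵥ cvec v := by
      intro v
      rw [dotProduct_comm, dotProduct_mulVec_conj, hSM, dotProduct_comm]
    simp only [cvec_mulVec, ← hS', dotProduct_mulVec_conj, hSM, hlin, h2]
    congr 3
    simp only [dotProduct, Matrix.mulVec_diagonal]
    refine Finset.sum_congr rfl fun i _ => ?_
    have : b i ≠ 0 := fun h0 => by simpa [h0] using hb i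
    field_simp

/-! ### Gaussian integrals against the Bargmann–Fock measure -/

/-- The complex vector with given real and imaginary parts. -/
def ofRealImag {n : ℕ} (v : Fin n ⊕ Fin n → ℝ) : Fin n → ℂ :=
  fun i => ⟨v (Sum.inl i), v (Sum.inr i)⟩

theorem integral_ofRealImag {n : ℕ} (f : (Fin n → ℂ) → ℂ) :
    ∫ z, f z = ∫ v : Fin n ⊕ Fin n → ℝ, f (ofRealImag v) := by
  have h1 := volume_measurePreserving_sumPiEquivProdPi (fun _ : Fin n ⊕ Fin n => ℝ)
  have h2 := (volume_measurePreserving_arrowProdEquivProdArrow ℝ ℝ (Fin n)).symm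
  have h3 := volume_preserving_pi fun _ : Fin n => Complex.volume_preserving_equiv_real_prod.symm
  have h := h3.comp (h2.comp h1)
  have hemb := (MeasurableEquiv.piCongrRight
    fun _ : Fin n => Complex.measurableEquivRealProd.symm).measurableEmbedding.comp
    ((MeasurableEquiv.arrowProdEquivProdArrow ℝ ℝ (Fin n)).symm.measurableEmbedding.comp
      (MeasurableEquiv.sumPiEquivProdPi (fun _ : Fin n ⊕ Fin n => ℝ)).measurableEmbedding)
  exact (h.integral_comp hemb f).symm

theorem integral_fockMeasure {n : ℕ} (f : (Fin n → ℂ) → ℂ) :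
    ∫ z, f z ∂(fockMeasure n) =
      ((π ^ n)⁻¹ : ℝ) * ∫ z, Complex.exp (-(z ⬝ᵥ star z)) * f z := by
  rw [fockMeasure, integral_withDensity_eq_integral_toReal_smul, ← integral_const_mul]
  · refine integral_congr_ae (Filter.Eventually.of_forall fun z => ?_)
    simp only
    rw [ENNReal.toReal_ofReal (by positivity), Complex.real_smul, Complex.ofReal_mul,
      Complex.ofReal_exp, mul_assoc]
    congr 3
    simp [dotProduct, Complex.mul_conj, Complex.normSq_eq_norm_sq]
  · fun_prop
  · simp

/-- The matrix of `(x, y) ↦ (x + i y, x - i y)`. -/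
def conjPairMatrix (n : ℕ) : Matrix (Fin n ⊕ Fin n) (Fin n ⊕ Fin n) ℂ :=
  Matrix.fromBlocks 1 (Complex.I • 1) 1 (-(Complex.I • 1))

theorem conjPairMatrix_mulVec {n : ℕ} (v : Fin n ⊕ Fin n → ℝ) :
    conjPairMatrix n *ᵥ cvec v = Sum.elim (ofRealImag v) (star (ofRealImag v)) := by
  have hv : cvec v = Sum.elim (fun i => (v (Sum.inl i) : ℂ)) (fun i => (v (Sum.inr i) : ℂ)) := by
    ext i; cases i <;> rfl
  rw [hv, conjPairMatrix, Matrix.fromBlocks_mulVec]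
  ext i
  cases i <;> simp [Matrix.smul_mulVec, Matrix.neg_mulVec, Complex.ext_iff, ofRealImag]

theorem norm_sq_det_conjPairMatrix (n : ℕ) : ‖(conjPairMatrix n).det‖ ^ 2 = 4 ^ n := by
  have h : conjPairMatrix n * (conjPairMatrix n)ᴴ = (2 : ℂ) • 1 := by
    rw [conjPairMatrix, Matrix.fromBlocks_conjTranspose, Matrix.fromBlocks_multiply,
      ← Matrix.fromBlocks_one, Matrix.fromBlocks_smul]
    congr 1 <;> simp [smul_smul, two_smul]
  have := congrArg (fun X => ‖Matrix.det X‖) h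
  simp only [Matrix.det_mul, Matrix.det_conjTranspose, Matrix.det_smul, norm_mul, norm_star,
    Matrix.det_one, norm_pow, mul_one, Fintype.card_sum, Fintype.card_fin] at this
  rw [sq, this, ← two_mul, pow_mul]
  norm_num

/-- The matrix of the quadratic form `2 z·w - z·αz - w·βw`. -/
def fockForm {n : ℕ} (α β : Matrix (Fin n) (Fin n) ℂ) : Matrix (Fin n ⊕ Fin n) (Fin n ⊕ Fin n) ℂ :=
  Matrix.fromBlocks (-α) 1 1 (-β)

theorem norm_det_fockForm {n : ℕ} (α β : Matrix (Fin n) (Fin n) ℂ) :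
    ‖(fockForm α β).det‖ = ‖(1 - α * β).det‖ := by
  set P : Matrix (Fin n ⊕ Fin n) (Fin n ⊕ Fin n) ℂ := Matrix.fromBlocks 0 1 1 0
  have hP : ‖P.det‖ = 1 := by
    have : P * P = 1 := by simp [P, Matrix.fromBlocks_multiply]
    have := congrArg (fun X => ‖Matrix.det X‖) this
    simp only [Matrix.det_mul, norm_mul, Matrix.det_one, norm_one] at this
    nlinarith [norm_nonneg P.det]
  -- A column operation followed by the swap `P` of the two column blocks makes the matrix block
  -- triangular.
  have h : fockForm α β * (Matrix.fromBlocks 1 β 0 1 * P) =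
      Matrix.fromBlocks (1 - α * β) (-α) 0 1 := by
    simp only [P, fockForm, Matrix.fromBlocks_multiply]
    congr 1 <;> simp
    abel
  have := congrArg (fun X => ‖Matrix.det X‖) h
  simpa [hP] using this

theorem fockForm_mulVec {n : ℕ} (α β : Matrix (Fin n) (Fin n) ℂ) (z w : Fin n → ℂ) :
    fockForm α β *ᵥ Sum.elim z w = Sum.elim (w - α *ᵥ z) (z - β *ᵥ w) := by
  rw [fockForm, Matrix.fromBlocks_mulVec]
  ext i
  cases i <;> simp [Matrix.neg_mulVec] <;> ring

/-- With the weight `exp(-z·z̄)` absorbed, the exponent is a quadratic form in `(z, z̄)`, pulled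
back to the real coordinates by `conjPairMatrix`. The source is parametrized as `s - βαs` because
`fockForm` sends `(s, αs)` to `(0, s - βαs)`, a source paired with `z̄` alone. -/
theorem exists_fock_gaussian {n : ℕ} {α β : Matrix (Fin n) (Fin n) ℂ} (hα : αᵀ = α) (hβ : βᵀ = β)
    (hpos : ∀ z : Fin n → ℂ, z ≠ 0 →
      0 < (2 * (z ⬝ᵥ star z) - z ⬝ᵥ (α *ᵥ z) - star z ⬝ᵥ (β *ᵥ star z)).re) :
    ∃ c : ℂ, ‖c‖ ^ 2 = ‖(1 - α * β).det‖⁻¹ ∧ ∀ s : Fin n → ℂ,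
      ∫ z, Complex.exp ((1 / 2) * (z ⬝ᵥ (α *ᵥ z)) + (1 / 2) * (star z ⬝ᵥ (β *ᵥ star z)) +
        (s - β *ᵥ (α *ᵥ s)) ⬝ᵥ star z) ∂(fockMeasure n) =
      c * Complex.exp ((1 / 2) * ((s - β *ᵥ (α *ᵥ s)) ⬝ᵥ (α *ᵥ s))) := by
  set C := conjPairMatrix n with hC
  set M := Cᵀ * fockForm α β * C with hMdef
  have hdet := norm_sq_det_conjPairMatrix n
  have hCu : IsUnit C.det := by
    rw [isUnit_iff_ne_zero]
    intro h
    rw [← hC, h, norm_zero, sq, zero_mul] at hdet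
    exact (pow_pos (by norm_num : (0 : ℝ) < 4) n).ne hdet
  have hM : Mᵀ = M := by
    simp only [hMdef, fockForm, Matrix.transpose_mul, Matrix.transpose_transpose,
      Matrix.fromBlocks_transpose, Matrix.transpose_neg, hα, hβ, Matrix.transpose_one,
      Matrix.mul_assoc]
  have hquad : ∀ v : Fin n ⊕ Fin n → ℝ, cvec v ⬝ᵥ (M *ᵥ cvec v) =
      2 * (ofRealImag v ⬝ᵥ star (ofRealImag v)) - ofRealImag v ⬝ᵥ (α *ᵥ ofRealImag v) -
        star (ofRealImag v) ⬝ᵥ (β *ᵥ star (ofRealImag v)) := by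
    intro v
    rw [hMdef, ← dotProduct_mulVec_conj, conjPairMatrix_mulVec, fockForm_mulVec,
      sumElim_dotProduct_sumElim, dotProduct_sub, dotProduct_sub,
      dotProduct_comm (star (ofRealImag v)) (ofRealImag v)]
    ring
  have hpos' : ∀ v : Fin n ⊕ Fin n → ℝ, v ≠ 0 → 0 < (cvec v ⬝ᵥ (M *ᵥ cvec v)).re := by
    intro v hv
    rw [hquad]
    refine hpos _ fun h => hv ?_
    ext i
    rcases i with i | i
    · exact congrArg Complex.re (congrFun h i)
    · exact congrArg Complex.im (congrFun h i)
  obtain ⟨h1, h2⟩ := norm_sq_gaussInt hM hpos'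
  refine ⟨((π ^ n)⁻¹ : ℝ) * gaussInt M, ?_, fun s => ?_⟩
  · have hMd : ‖M.det‖ = 4 ^ n * ‖(1 - α * β).det‖ := by
      rw [hMdef, Matrix.det_mul, Matrix.det_mul, Matrix.det_transpose, norm_mul, norm_mul,
        norm_det_fockForm, ← hdet]
      ring
    rw [norm_mul, mul_pow, h1, hMd, Complex.norm_real, Real.norm_of_nonneg (by positivity),
      Fintype.card_sum, Fintype.card_fin, ← two_mul, pow_mul, mul_pow 2 π, mul_pow, inv_pow,
      ← pow_mul, ← pow_mul, mul_comm 2 n]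
    have h4 : (2 ^ 2 : ℝ) = 4 := by norm_num
    rw [pow_mul' (2 : ℝ), h4, pow_mul' π]
    field_simp
  · set t : Fin n ⊕ Fin n → ℂ := Sum.elim s (α *ᵥ s) with ht
    have hu : C *ᵥ (C⁻¹ *ᵥ t) = t := by
      rw [Matrix.mulVec_mulVec, Matrix.mul_nonsing_inv _ hCu, Matrix.one_mulVec]
    have hGt : fockForm α β *ᵥ t = Sum.elim (0 : Fin n → ℂ) (s - β *ᵥ (α *ᵥ s)) := by
      rw [ht, fockForm_mulVec, sub_self]
    have hlin : ∀ v : Fin n ⊕ Fin n → ℝ, (M *ᵥ (C⁻¹ *ᵥ t)) ⬝ᵥ cvec v =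
        (s - β *ᵥ (α *ᵥ s)) ⬝ᵥ star (ofRealImag v) := by
      intro v
      rw [dotProduct_comm, hMdef, ← dotProduct_mulVec_conj, hu, hGt, conjPairMatrix_mulVec,
        sumElim_dotProduct_sumElim, dotProduct_zero, zero_add, dotProduct_comm]
    have hval : (C⁻¹ *ᵥ t) ⬝ᵥ (M *ᵥ (C⁻¹ *ᵥ t)) = (s - β *ᵥ (α *ᵥ s)) ⬝ᵥ (α *ᵥ s) := by
      rw [hMdef, ← dotProduct_mulVec_conj, hu, hGt, ht, sumElim_dotProduct_sumElim,
        dotProduct_zero, zero_add, dotProduct_comm]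
    have := h2 (C⁻¹ *ᵥ t)
    rw [hval] at this
    rw [integral_fockMeasure, integral_ofRealImag, mul_assoc, ← this]
    congr 2
    ext v
    rw [hlin, hquad, ← Complex.exp_add]
    congr 1
    ring

/-! ### Autonne–Takagi factorization -/

/-- A symmetric antilinear map has an eigenvector with a nonnegative eigenvalue. -/
theorem exists_con_eigenvector {E : Type*} [NormedAddCommGroup E] [InnerProductSpace ℂ E]
    [FiniteDimensional ℂ E] [Nontrivial E] (T : E →ₗ⋆[ℂ] E)
    (hT : ∀ x y, inner ℂ (T x) y = inner ℂ (T y) x) :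
    ∃ (u : E) (s : ℝ), ‖u‖ = 1 ∧ 0 ≤ s ∧ T u = (s : ℂ) • u := by
  -- Over `ℝ` the map is linear, and symmetric for the real part of the inner product, so the real
  -- spectral theorem applies.
  let _ : InnerProductSpace ℝ E := InnerProductSpace.rclikeToReal ℂ E
  have : FiniteDimensional ℝ E := FiniteDimensional.complexToReal E
  let T' : E →ₗ[ℝ] E :=
    { toFun := T
      map_add' := T.map_add
      map_smul' := fun r x => by
        have := T.map_smulₛₗ (r : ℂ) x
        simpa using this }
  have hsym : T'.IsSymmetric := by
    intro x y
    change (inner ℂ (T x) y).re = (inner ℂ x (T y)).re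
    rw [hT, ← inner_conj_symm x (T y), Complex.conj_re]
  obtain ⟨m, hm⟩ : ∃ m, Module.finrank ℝ E = m + 1 :=
    ⟨Module.finrank ℝ E - 1, by have := Module.finrank_pos (R := ℝ) (M := E); omega⟩
  set u := hsym.eigenvectorBasis hm 0
  have hu : ‖u‖ = 1 := (hsym.eigenvectorBasis hm).orthonormal.1 0
  have hTu : T u = ((hsym.eigenvalues hm 0 : ℝ) : ℂ) • u := by
    have := hsym.apply_eigenvectorBasis hm 0
    exact this
  rcases le_total 0 (hsym.eigenvalues hm 0) with h | h
  · exact ⟨u, _, hu, h, hTu⟩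
  -- Antilinearity gives `T(iu) = -i T u`, so multiplying the eigenvector by `i` flips the sign of
  -- the eigenvalue.
  · refine ⟨Complex.I • u, -(hsym.eigenvalues hm 0), by simp [norm_smul, hu], by linarith, ?_⟩
    rw [T.map_smulₛₗ, hTu, smul_smul, smul_smul]
    congr 1
    simp [mul_comm]

/-- Induction on the dimension: the symmetry of `T` makes the orthogonal complement of an
eigenvector invariant. The space is quantified inside so that the hypothesis applies to that
complement. -/
theorem exists_con_eigenbasis (n : ℕ) : ∀ (E : Type) [NormedAddCommGroup E]
    [InnerProductSpace ℂ E] [FiniteDimensional ℂ E] (_ : Module.finrank ℂ E = n)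
    (T : E →ₗ⋆[ℂ] E) (_ : ∀ x y, inner ℂ (T x) y = inner ℂ (T y) x),
    ∃ (b : Fin n → E) (s : Fin n → ℝ), Orthonormal ℂ b ∧ (∀ i, 0 ≤ s i) ∧
      ∀ i, T (b i) = (s i : ℂ) • b i := by
  induction n with
  | zero =>
    intro E _ _ _ _ T _
    exact ⟨Fin.elim0, Fin.elim0, ⟨fun i => i.elim0, fun i => i.elim0⟩, fun i => i.elim0,
      fun i => i.elim0⟩
  | succ n ih =>
    intro E _ _ _ hn T hT
    have : Nontrivial E := Module.nontrivial_of_finrank_pos (R := ℂ) (by omega)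
    obtain ⟨u, s₀, hu, hs₀, hTu⟩ := exists_con_eigenvector T hT
    have hu0 : u ≠ 0 := by rintro rfl; simp at hu
    have : Fact (Module.finrank ℂ E = n + 1) := ⟨hn⟩
    have hW : ∀ x ∈ (ℂ ∙ u)ᗮ, T x ∈ (ℂ ∙ u)ᗮ := by
      intro x hx
      rw [Submodule.mem_orthogonal_singleton_iff_inner_right] at hx
      rw [Submodule.mem_orthogonal_singleton_iff_inner_left, hT, hTu, inner_smul_left, hx, mul_zero]
    let T' : (ℂ ∙ u)ᗮ →ₗ⋆[ℂ] (ℂ ∙ u)ᗮ :=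
      { toFun := fun x => ⟨T x, hW x x.2⟩
        map_add' := fun x y => by ext; simp
        map_smul' := fun c x => by ext; simp [T.map_smulₛₗ] }
    obtain ⟨b, s, hb, hs, hTb⟩ := ih (ℂ ∙ u)ᗮ (Submodule.finrank_orthogonal_span_singleton hu0) T'
      (fun x y => hT x y)
    refine ⟨Fin.cons u fun i => (b i : E), Fin.cons s₀ s, ?_, ?_, ?_⟩
    · have hub : ∀ i, inner ℂ u (b i : E) = 0 := fun i =>
        Submodule.mem_orthogonal_singleton_iff_inner_right.1 (b i).2
      rw [orthonormal_iff_ite] at hb ⊢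
      intro i j
      refine Fin.cases ?_ (fun i => ?_) i <;> refine Fin.cases ?_ (fun j => ?_) j
      · simp [inner_self_eq_norm_sq_to_K, hu]
      · simpa [Fin.ext_iff] using hub j
      · have := hub i
        rw [← inner_conj_symm, map_eq_zero] at this
        simpa [Fin.ext_iff] using this
      · simpa using hb i j
    · intro i
      refine Fin.cases ?_ (fun i => ?_) i
      · simpa using hs₀
      · simpa using hs i
    · intro i
      refine Fin.cases ?_ (fun i => ?_) i
      · simpa using hTu
      · simpa [T'] using congrArg Subtype.val (hTb i)

/-- Autonne-Takagi factorization of a complex symmetric matrix. -/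
theorem exists_isSymmSVD {n : ℕ} {A : Matrix (Fin n) (Fin n) ℂ} (hA : Aᵀ = A) :
    ∃ (U : Matrix (Fin n) (Fin n) ℂ) (σ : Fin n → ℝ), IsSymmSVD A U σ := by
  -- The map is `x ↦ A x̄`, symmetric because `Aᵀ = A`. If the columns of `U` are its eigenbasis,
  -- then `A Ū = U Σ`, and `Ū Uᵀ = 1` gives the factorization.
  let T : EuclideanSpace ℂ (Fin n) →ₗ⋆[ℂ] EuclideanSpace ℂ (Fin n) :=
    { toFun := fun x => WithLp.toLp 2 (A *ᵥ star x.ofLp)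
      map_add' := fun x y => by ext i; simp [Matrix.mulVec_add]
      map_smul' := fun c x => by ext i; simp [Matrix.mulVec_smul] }
  have hT : ∀ x y, inner ℂ (T x) y = inner ℂ (T y) x := by
    intro x y
    rw [EuclideanSpace.inner_eq_star_dotProduct, EuclideanSpace.inner_eq_star_dotProduct]
    change y.ofLp ⬝ᵥ star (A *ᵥ star x.ofLp) = x.ofLp ⬝ᵥ star (A *ᵥ star y.ofLp)
    rw [Matrix.star_mulVec, Matrix.star_mulVec, star_star, star_star, dotProduct_comm,
      ← Matrix.dotProduct_mulVec, ← Matrix.mulVec_transpose, Matrix.conjTranspose,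
      ← Matrix.transpose_map, hA, hA]
  obtain ⟨b, s, hb, hs, hTb⟩ := exists_con_eigenbasis n _ (by simp) T hT
  set U : Matrix (Fin n) (Fin n) ℂ := Matrix.of fun i j => b j i with hU
  have hUU : Uᴴ * U = 1 := by
    ext i j
    have := (orthonormal_iff_ite.1 hb) i j
    rw [EuclideanSpace.inner_eq_star_dotProduct] at this
    rw [Matrix.one_apply, ← this, Matrix.mul_apply, dotProduct]
    exact Finset.sum_congr rfl fun k _ => by simp [hU, mul_comm]
  have hUU' : U * Uᴴ = 1 := mul_eq_one_comm.1 hUU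
  refine ⟨U, s, Matrix.mem_unitaryGroup_iff.2 hUU', hs, ?_⟩
  have hAU : A * U.map star = U * Matrix.diagonal fun i => (s i : ℂ) := by
    ext i j
    have := congrArg (fun x : EuclideanSpace ℂ (Fin n) => x i) (hTb j)
    rw [Matrix.mul_diagonal]
    simpa [T, hU, Matrix.mul_apply, Matrix.mulVec, dotProduct, mul_comm] using this
  rw [← hAU, Matrix.mul_assoc]
  have : U.map star * Uᵀ = 1 := by
    have := congrArg Matrix.transpose hUU'
    rwa [Matrix.transpose_mul, Matrix.transpose_one, Matrix.conjTranspose,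
      Matrix.transpose_map.symm, Matrix.transpose_transpose] at this
  rw [this, Matrix.mul_one]

/-! ### Inverse square roots of unitarily diagonalized matrices -/

section MatrixCalculus

variable {n : ℕ}

/-- `d ↦ V diag(d) V*` as a star algebra homomorphism, for unitary `V`. -/
def conjDiagonal (V : Matrix.unitaryGroup (Fin n) ℂ) :
    (Fin n → ℂ) →⋆ₐ[ℂ] Matrix (Fin n) (Fin n) ℂ where
  toFun d := V * Matrix.diagonal d * (V : Matrix (Fin n) (Fin n) ℂ)ᴴ
  map_one' := by
    rw [Matrix.diagonal_one', Matrix.mul_one]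
    exact Matrix.mem_unitaryGroup_iff.1 V.2
  map_mul' d e := by
    have h : (V : Matrix (Fin n) (Fin n) ℂ)ᴴ * V = 1 := Matrix.mem_unitaryGroup_iff'.1 V.2
    have : Matrix.diagonal (d * e) = Matrix.diagonal d * Matrix.diagonal e :=
      (Matrix.diagonal_mul_diagonal d e).symm
    rw [this]
    simp only [Matrix.mul_assoc]
    rw [← Matrix.mul_assoc _ (V : Matrix (Fin n) (Fin n) ℂ), h, Matrix.one_mul]
  map_zero' := by simp
  map_add' d e := by
    have : Matrix.diagonal (d + e) = Matrix.diagonal d + Matrix.diagonal e :=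
      (Matrix.diagonal_add d e).symm
    rw [this, Matrix.mul_add, Matrix.add_mul]
  commutes' r := by
    have h : (V : Matrix (Fin n) (Fin n) ℂ) * (V : Matrix (Fin n) (Fin n) ℂ)ᴴ = 1 :=
      Matrix.mem_unitaryGroup_iff.1 V.2
    have : Matrix.diagonal (algebraMap ℂ (Fin n → ℂ) r) = r • (1 : Matrix (Fin n) (Fin n) ℂ) := by
      ext i j
      simp [Matrix.diagonal_apply, Matrix.one_apply]
    rw [this, Matrix.mul_smul, Matrix.smul_mul, Matrix.mul_one, h, Algebra.algebraMap_eq_smul_one]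
  map_star' d := by
    rw [Matrix.star_eq_conjTranspose, Matrix.conjTranspose_mul, Matrix.conjTranspose_mul,
      Matrix.conjTranspose_conjTranspose, Matrix.diagonal_conjTranspose, Matrix.mul_assoc]

theorem conjDiagonal_apply (V : Matrix.unitaryGroup (Fin n) ℂ) (d : Fin n → ℂ) :
    conjDiagonal V d = V * Matrix.diagonal d * (V : Matrix (Fin n) (Fin n) ℂ)ᴴ := rfl

/-- The spectrum lies in the finite set of entries of `d`, where the function agrees with a Lagrange
interpolation polynomial; polynomials commute with the algebra homomorphism `conjDiagonal V`. -/
theorem invSqrt_conjDiagonal (V : Matrix.unitaryGroup (Fin n) ℂ) (d : Fin n → ℝ) :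
    invSqrt (conjDiagonal V (cvec d)) = conjDiagonal V (cvec fun i => (Real.sqrt (d i))⁻¹) := by
  let φ : (Fin n → ℂ) →ₐ[ℝ] Matrix (Fin n) (Fin n) ℂ :=
    (conjDiagonal V).toAlgHom.restrictScalars ℝ
  have hspec : spectrum ℝ (conjDiagonal V (cvec d)) ⊆ Set.range d := by
    refine (AlgHom.spectrum_apply_subset φ (cvec d)).trans ?_
    rw [Pi.spectrum_eq]
    refine Set.iUnion_subset fun i => ?_
    have : cvec d i = algebraMap ℝ ℂ (d i) := rfl
    rw [this, spectrum.scalar_eq, Set.singleton_subset_iff]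
    exact ⟨i, rfl⟩
  set p := Lagrange.interpolate (Finset.univ.image d) id fun x => (Real.sqrt x)⁻¹
  have hp : ∀ i, p.eval (d i) = (Real.sqrt (d i))⁻¹ := fun i =>
    Lagrange.eval_interpolate_at_node (v := id) _ (Set.injOn_id _)
      (Finset.mem_image_of_mem d (Finset.mem_univ i))
  have hsa : IsSelfAdjoint (cvec d) := by
    ext i
    simp [cvec]
  rw [invSqrt, cfc_congr (g := fun x => p.eval x), cfc_polynomial p _ (hsa.map (conjDiagonal V))]
  · change Polynomial.aeval (φ (cvec d)) p = φ _
    rw [Polynomial.aeval_algHom_apply]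
    congr 1
    ext i
    change Pi.evalAlgHom ℝ (fun _ : Fin n => ℂ) i (Polynomial.aeval (cvec d) p) = _
    rw [← Polynomial.aeval_algHom_apply]
    change Polynomial.aeval (algebraMap ℝ ℂ (d i)) p = _
    rw [Polynomial.aeval_algebraMap_apply, Polynomial.coe_aeval_eq_eval, hp]
    rfl
  · intro x hx
    obtain ⟨i, rfl⟩ := hspec hx
    exact (hp i).symm

theorem det_conjDiagonal (V : Matrix.unitaryGroup (Fin n) ℂ) (d : Fin n → ℂ) :
    (conjDiagonal V d).det = ∏ i, d i := by
  have h : (V : Matrix (Fin n) (Fin n) ℂ)ᴴ * V = 1 := Matrix.mem_unitaryGroup_iff'.1 V.2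
  rw [conjDiagonal_apply, Matrix.det_mul_comm, ← Matrix.mul_assoc, h, Matrix.one_mul,
    Matrix.det_diagonal]

end MatrixCalculus

/-! ### Consequences of the norm bound on `A` -/

section Norms

variable {n : ℕ}

theorem norm_toLp_star (z : Fin n → ℂ) :
    ‖WithLp.toLp 2 (star z)‖ = ‖WithLp.toLp 2 z‖ := by
  simp [EuclideanSpace.norm_eq]

theorem norm_dotProduct_le (z w : Fin n → ℂ) :
    ‖z ⬝ᵥ w‖ ≤ ‖WithLp.toLp 2 z‖ * ‖WithLp.toLp 2 w‖ := by
  have := norm_inner_le_norm (𝕜 := ℂ) (WithLp.toLp 2 (star z)) (WithLp.toLp 2 w)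
  rwa [EuclideanSpace.inner_eq_star_dotProduct, star_star, dotProduct_comm,
    norm_toLp_star] at this

theorem dotProduct_star_self (z : Fin n → ℂ) :
    z ⬝ᵥ star z = ((‖WithLp.toLp 2 z‖ ^ 2 : ℝ) : ℂ) := by
  rw [EuclideanSpace.norm_sq_eq]
  simp [dotProduct, Complex.mul_conj, Complex.normSq_eq_norm_sq]

theorem norm_mulVec_lt {A : Matrix (Fin n) (Fin n) ℂ} (hA : A ∈ domain n) {z : Fin n → ℂ}
    (hz : z ≠ 0) : ‖WithLp.toLp 2 (A *ᵥ z)‖ < ‖WithLp.toLp 2 z‖ := by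
  have h := (Matrix.toEuclideanCLM (n := Fin n) (𝕜 := ℂ) A).le_opNorm (WithLp.toLp 2 z)
  rw [Matrix.toEuclideanCLM_toLp] at h
  have hz' : 0 < ‖WithLp.toLp 2 z‖ := by
    rw [norm_pos_iff]
    intro h0
    exact hz (congrArg WithLp.ofLp h0)
  nlinarith [hA.2]

theorem norm_dotProduct_mulVec_lt {A : Matrix (Fin n) (Fin n) ℂ} (hA : A ∈ domain n)
    {z : Fin n → ℂ} (hz : z ≠ 0) : ‖z ⬝ᵥ (A *ᵥ z)‖ < ‖WithLp.toLp 2 z‖ ^ 2 := by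
  have h1 := norm_dotProduct_le z (A *ᵥ z)
  have h2 := norm_mulVec_lt hA hz
  have h3 := norm_nonneg (WithLp.toLp 2 (A *ᵥ z))
  nlinarith

theorem det_one_add_ne_zero {A : Matrix (Fin n) (Fin n) ℂ} (hA : A ∈ domain n) :
    (1 + A).det ≠ 0 := by
  intro h
  obtain ⟨v, hv, h0⟩ := Matrix.exists_mulVec_eq_zero_iff.2 h
  rw [Matrix.add_mulVec, Matrix.one_mulVec, add_comm] at h0
  have := norm_mulVec_lt hA hv
  rw [eq_neg_of_add_eq_zero_left h0, WithLp.toLp_neg, norm_neg] at this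
  exact lt_irrefl _ this

theorem star_mulVec_conj (A : Matrix (Fin n) (Fin n) ℂ) (z : Fin n → ℂ) :
    star (A *ᵥ z) = conjM A *ᵥ star z := by
  ext i
  simp [conjM, Matrix.mulVec, dotProduct]

theorem conjTranspose_eq_conjM {A : Matrix (Fin n) (Fin n) ℂ} (hA : Aᵀ = A) : Aᴴ = conjM A := by
  rw [Matrix.conjTranspose, hA]
  rfl

end Norms

/-! ### Singular values and the blocks of `ι(A)` -/

section SVD

variable {n : ℕ} {A U : Matrix (Fin n) (Fin n) ℂ} {σ : Fin n → ℝ}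

theorem IsSymmSVD.sigma_lt_one (h : IsSymmSVD A U σ) (hA : A ∈ domain n) (i : Fin n) :
    σ i < 1 := by
  obtain ⟨hU, hσ, hAU⟩ := h
  have hUU : Uᴴ * U = 1 := Matrix.mem_unitaryGroup_iff'.1 hU
  set u := U *ᵥ Pi.single i 1 with hu
  have hU' : Uᵀ * conjM U = 1 := by
    have := congrArg Matrix.transpose hUU
    rwa [Matrix.transpose_mul, Matrix.transpose_one, Matrix.conjTranspose,
      ← Matrix.transpose_map, Matrix.transpose_transpose] at this
  have hs : star (Pi.single i 1 : Fin n → ℂ) = Pi.single i 1 := by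
    ext j
    by_cases hj : j = i
    · subst hj; simp
    · simp [hj]
  -- The `i`-th column of `U` is an eigenvector of `z ↦ Az̄`, so `‖A‖ < 1` forces `σᵢ < 1`.
  have hAu : A *ᵥ star u = (σ i : ℂ) • u := by
    rw [hu, star_mulVec_conj, hs, hAU, Matrix.mulVec_mulVec, Matrix.mul_assoc, hU',
      Matrix.mul_one, ← Matrix.mulVec_mulVec, ← Matrix.mulVec_smul]
    congr 1
    ext j
    by_cases hj : j = i
    · subst hj; simp
    · simp [hj]
  have hu0 : u ≠ 0 := by
    intro h0
    have : Uᴴ *ᵥ u = Pi.single i 1 := by rw [hu, Matrix.mulVec_mulVec, hUU, Matrix.one_mulVec]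
    rw [h0, Matrix.mulVec_zero] at this
    simpa using congrFun this i
  have hlt := norm_mulVec_lt hA (star_ne_zero.2 hu0)
  rw [hAu, norm_toLp_star, WithLp.toLp_smul, norm_smul, Complex.norm_real,
    Real.norm_of_nonneg (hσ i)] at hlt
  have := norm_nonneg (WithLp.toLp 2 u)
  nlinarith

theorem IsSymmSVD.one_sub_mul_conjTranspose (h : IsSymmSVD A U σ) :
    1 - A * Aᴴ = conjDiagonal ⟨U, h.1⟩ (cvec fun i => 1 - σ i ^ 2) := by
  obtain ⟨hU, hσ, hAU⟩ := h
  have hU' : Uᵀ * Uᵀᴴ = 1 := by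
    have := congrArg Matrix.transpose (Matrix.mem_unitaryGroup_iff'.1 hU)
    rwa [Matrix.transpose_mul, Matrix.transpose_one, Matrix.star_eq_conjTranspose] at this
  have hd : (cvec fun i => 1 - σ i ^ 2) = 1 - cvec σ * star (cvec σ) := by
    ext i
    simp [cvec, sq]
  rw [hd, map_sub, map_one, map_mul, map_star, conjDiagonal_apply, sub_right_inj]
  simp only [hAU, Matrix.star_eq_conjTranspose, Matrix.conjTranspose_mul,
    Matrix.conjTranspose_conjTranspose]
  have hUU : Uᴴ * U = 1 := Matrix.mem_unitaryGroup_iff'.1 hU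
  have e1 : ∀ X, Uᵀ * (Uᵀᴴ * X) = X := fun X => by rw [← Matrix.mul_assoc, hU', Matrix.one_mul]
  have e2 : ∀ X, Uᴴ * (U * X) = X := fun X => by rw [← Matrix.mul_assoc, hUU, Matrix.one_mul]
  simp only [Matrix.mul_assoc, e1, e2]
  rfl

end SVD

section InvSqrt

variable {n : ℕ} {A U : Matrix (Fin n) (Fin n) ℂ} {σ : Fin n → ℝ}

theorem conjM_conjM (A : Matrix (Fin n) (Fin n) ℂ) : conjM (conjM A) = A := by
  ext i j
  simp [conjM]

theorem conjM_mul (A B : Matrix (Fin n) (Fin n) ℂ) : conjM (A * B) = conjM A * conjM B :=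
  Matrix.map_mul

theorem conjM_conjTranspose (A : Matrix (Fin n) (Fin n) ℂ) : (conjM A)ᴴ = Aᵀ := by
  ext i j
  simp [conjM]

theorem IsSymmSVD.conj (h : IsSymmSVD A U σ) : IsSymmSVD (conjM A) (conjM U) σ := by
  obtain ⟨hU, hσ, hAU⟩ := h
  refine ⟨?_, hσ, ?_⟩
  · have := congrArg Matrix.transpose (Matrix.mem_unitaryGroup_iff'.1 hU)
    rw [Matrix.mem_unitaryGroup_iff', Matrix.star_eq_conjTranspose, conjM_conjTranspose]
    rwa [Matrix.transpose_mul, Matrix.transpose_one, Matrix.star_eq_conjTranspose,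
      Matrix.conjTranspose, ← Matrix.transpose_map, Matrix.transpose_transpose] at this
  · rw [hAU, conjM_mul, conjM_mul]
    congr 2
    ext i j
    by_cases hij : i = j
    · subst hij; simp [conjM]
    · simp [conjM, hij]

/-- This is the intertwining relation `A* f(AA*) = f(A*A) A*` in diagonal form: `A* = Ū Σ U*`, and
diagonal matrices commute. -/
theorem IsSymmSVD.conjTranspose_mul_conjDiagonal (h : IsSymmSVD A U σ) (f : Fin n → ℂ) :
    Aᴴ * conjDiagonal ⟨U, h.1⟩ f = conjDiagonal ⟨conjM U, h.conj.1⟩ f * Aᴴ := by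
  have hAU : Aᴴ = conjM U * Matrix.diagonal (cvec σ) * Uᴴ := by
    rw [h.2.2, Matrix.conjTranspose_mul, Matrix.conjTranspose_mul, ← Matrix.mul_assoc,
      Matrix.diagonal_conjTranspose]
    congr 2
    ext i j
    by_cases hij : i = j
    · subst hij; simp [cvec]
    · simp [hij]
  have h1 : Uᴴ * U = 1 := Matrix.mem_unitaryGroup_iff'.1 h.1
  have h2 : (conjM U)ᴴ * conjM U = 1 := Matrix.mem_unitaryGroup_iff'.1 h.conj.1
  have e1 : ∀ X, Uᴴ * (U * X) = X := fun X => by rw [← Matrix.mul_assoc, h1, Matrix.one_mul]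
  have e2 : ∀ X, (conjM U)ᴴ * (conjM U * X) = X := fun X => by
    rw [← Matrix.mul_assoc, h2, Matrix.one_mul]
  rw [conjDiagonal_apply, conjDiagonal_apply, hAU]
  simp only [Matrix.mul_assoc, e1, e2]
  rw [← Matrix.mul_assoc (Matrix.diagonal _) (Matrix.diagonal _),
    ← Matrix.mul_assoc (Matrix.diagonal _) (Matrix.diagonal _), Matrix.diagonal_mul_diagonal,
    Matrix.diagonal_mul_diagonal]
  simp only [mul_comm]

theorem IsSymmSVD.invSqrt_eq (h : IsSymmSVD A U σ) :
    invSqrt (1 - A * Aᴴ) =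
      conjDiagonal ⟨U, h.1⟩ (cvec fun i => (Real.sqrt (1 - σ i ^ 2))⁻¹) := by
  rw [h.one_sub_mul_conjTranspose, invSqrt_conjDiagonal]

theorem IsSymmSVD.one_sub_sq_pos (h : IsSymmSVD A U σ) (hA : A ∈ domain n) (i : Fin n) :
    0 < 1 - σ i ^ 2 := by
  nlinarith [h.sigma_lt_one hA i, h.2.1 i]

theorem IsSymmSVD.invSqrt_mul_self (h : IsSymmSVD A U σ) (hA : A ∈ domain n) :
    invSqrt (1 - A * Aᴴ) * invSqrt (1 - A * Aᴴ) * (1 - A * Aᴴ) = 1 := by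
  rw [h.invSqrt_eq, h.one_sub_mul_conjTranspose, ← map_mul, ← map_mul, ← map_one (conjDiagonal _)]
  congr 1
  ext i
  have h0 := h.one_sub_sq_pos hA i
  have h1 := Real.mul_self_sqrt h0.le
  have h2 := (Real.sqrt_pos.2 h0).ne'
  simp only [cvec, Pi.mul_apply, Pi.one_apply]
  norm_cast
  rw [← mul_inv, h1, inv_mul_cancel₀ h0.ne']

theorem IsSymmSVD.invSqrt_isHermitian (h : IsSymmSVD A U σ) :
    (invSqrt (1 - A * Aᴴ))ᴴ = invSqrt (1 - A * Aᴴ) := by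
  rw [h.invSqrt_eq, ← Matrix.star_eq_conjTranspose, ← map_star]
  congr 1
  ext i
  simp [cvec]

theorem conjTranspose_mul_self_eq (hA : Aᵀ = A) : Aᴴ * A = conjM A * (conjM A)ᴴ := by
  rw [conjM_conjTranspose, hA, conjTranspose_eq_conjM hA]

/-- These are the facts that simplify the metaplectic kernel of `ι(A)`: `det λ` is a positive real,
and `λ⁻¹μ = A*` by the intertwining relation. -/
theorem iota_block_identities (hA : A ∈ domain n) :
    ∃ r : ℝ, 0 < r ∧ (invSqrt (1 - Aᴴ * A)).det = r ∧ r ^ 2 * ‖(1 - A * conjM A).det‖ = 1 ∧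
      (invSqrt (1 - Aᴴ * A))⁻¹ * (Aᴴ * invSqrt (1 - A * Aᴴ)) = Aᴴ := by
  obtain ⟨U, σ, h⟩ := exists_isSymmSVD hA.1
  have hΛ : invSqrt (1 - Aᴴ * A) =
      conjDiagonal ⟨conjM U, h.conj.1⟩ (cvec fun i => (Real.sqrt (1 - σ i ^ 2))⁻¹) := by
    rw [conjTranspose_mul_self_eq hA.1, h.conj.invSqrt_eq]
  have hdet : (invSqrt (1 - Aᴴ * A)).det = ((∏ i, (Real.sqrt (1 - σ i ^ 2))⁻¹ : ℝ) : ℂ) := by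
    rw [hΛ, det_conjDiagonal, Complex.ofReal_prod]
    rfl
  have hpos : 0 < ∏ i, (Real.sqrt (1 - σ i ^ 2))⁻¹ :=
    Finset.prod_pos fun i _ => inv_pos.2 (Real.sqrt_pos.2 (h.one_sub_sq_pos hA i))
  refine ⟨_, hpos, hdet, ?_, ?_⟩
  · rw [← conjTranspose_eq_conjM hA.1, h.one_sub_mul_conjTranspose, det_conjDiagonal, norm_prod,
      ← Finset.prod_pow, ← Finset.prod_mul_distrib]
    refine Finset.prod_eq_one fun i _ => ?_
    have h0 := h.one_sub_sq_pos hA i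
    rw [cvec, Complex.norm_real, Real.norm_of_nonneg h0.le, inv_pow, Real.sq_sqrt h0.le,
      inv_mul_cancel₀ h0.ne']
  · have hu : IsUnit (invSqrt (1 - Aᴴ * A)).det := by
      rw [hdet]
      exact (Complex.ofReal_ne_zero.2 hpos.ne').isUnit
    rw [h.invSqrt_eq, h.conjTranspose_mul_conjDiagonal, ← hΛ, ← Matrix.mul_assoc,
      Matrix.nonsing_inv_mul _ hu, Matrix.one_mul]

end InvSqrt

/-! ### The squeezing map in real phase-space coordinates -/

section RealForm

variable {n : ℕ} {A U : Matrix (Fin n) (Fin n) ℂ} {σ : Fin n → ℝ}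

theorem rotQ_mul (U V : Matrix (Fin n) (Fin n) ℂ) : rotQ (U * V) = rotQ U * rotQ V := by
  rw [rotQ, rotQ, rotQ, Matrix.fromBlocks_multiply]
  congr 1 <;> ext i j <;>
    simp [Matrix.mul_apply, Complex.re_sum, Complex.im_sum, Finset.sum_add_distrib,
      sub_eq_add_neg, add_comm]

theorem rotQ_one : rotQ (1 : Matrix (Fin n) (Fin n) ℂ) = 1 := by
  rw [rotQ, ← Matrix.fromBlocks_one]
  congr 1 <;> ext i j <;> by_cases hij : i = j <;> simp [hij, Matrix.one_apply]

theorem rotQ_conjTranspose (U : Matrix (Fin n) (Fin n) ℂ) : rotQ Uᴴ = (rotQ U)ᵀ := by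
  rw [rotQ, rotQ, Matrix.fromBlocks_transpose]
  congr 1
  all_goals
    ext i j
    simp

theorem rotQ_I : rotQ (Complex.I • (1 : Matrix (Fin n) (Fin n) ℂ)) = Matrix.J (Fin n) ℝ := by
  rw [rotQ, Matrix.J]
  congr 1 <;> ext i j <;> by_cases hij : i = j <;> simp [hij, Matrix.one_apply]

theorem toReal_mulVec (U : Matrix (Fin n) (Fin n) ℂ) (z : Fin n → ℂ) :
    toReal (U *ᵥ z) = rotQ U *ᵥ toReal z := by
  rw [toReal, toReal, rotQ, Matrix.fromBlocks_mulVec]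
  ext i
  cases i <;> simp [Matrix.mulVec, dotProduct, Complex.re_sum, Complex.im_sum,
    Finset.sum_add_distrib, sub_eq_add_neg, add_comm]

theorem toReal_toComplex (q p : Fin n → ℝ) : toReal (toComplex q p) = Sum.elim q p := by
  ext i
  cases i <;> simp [toReal, toComplex]

theorem rotQ_mul_transpose (hU : U ∈ Matrix.unitaryGroup (Fin n) ℂ) :
    rotQ U * (rotQ U)ᵀ = 1 := by
  rw [← rotQ_conjTranspose, ← rotQ_mul, ← Matrix.star_eq_conjTranspose,
    Matrix.mem_unitaryGroup_iff.1 hU, rotQ_one]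

/-- `rotQ` is multiplicative and sends `i` to `J`. Since `U` commutes with `i`, its image commutes
with `J`, and orthogonality finishes. -/
theorem rotQ_mem_symplecticGroup (hU : U ∈ Matrix.unitaryGroup (Fin n) ℂ) :
    rotQ U ∈ Matrix.symplecticGroup (Fin n) ℝ := by
  rw [SymplecticGroup.mem_iff, ← rotQ_I, ← rotQ_mul, Matrix.mul_smul, Matrix.mul_one]
  have : Complex.I • U = (Complex.I • 1) * U := by rw [Matrix.smul_mul, Matrix.one_mul]
  rw [this, rotQ_mul, Matrix.mul_assoc, rotQ_mul_transpose hU, Matrix.mul_one]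

theorem axisA_pos (h0 : ∀ i, 0 ≤ σ i) (h1 : ∀ i, σ i < 1) (i : Fin n) : 0 < axisA σ i :=
  Real.sqrt_pos.2 (div_pos (by linarith [h0 i]) (by linarith [h1 i]))

theorem axisB_eq_inv (σ : Fin n → ℝ) (i : Fin n) : axisB σ i = (axisA σ i)⁻¹ := by
  rw [axisA, axisB, ← Real.sqrt_inv, inv_div]

theorem squeezeD_mem_symplecticGroup (h0 : ∀ i, 0 ≤ σ i) (h1 : ∀ i, σ i < 1) :
    squeezeD σ ∈ Matrix.symplecticGroup (Fin n) ℝ := by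
  have e : squeezeD σ =
      Matrix.fromBlocks (Matrix.diagonal (axisB σ)) 0 0 (Matrix.diagonal (axisA σ)) := by
    rw [squeezeD, Matrix.fromBlocks_diagonal]
  have hab : Matrix.diagonal (axisB σ) * Matrix.diagonal (axisA σ) = 1 := by
    rw [Matrix.diagonal_mul_diagonal, ← Matrix.diagonal_one]
    congr 1
    ext i
    rw [axisB_eq_inv, inv_mul_cancel₀ (axisA_pos h0 h1 i).ne']
  rw [SymplecticGroup.mem_iff, e, Matrix.J, Matrix.fromBlocks_transpose,
    Matrix.fromBlocks_multiply, Matrix.fromBlocks_multiply]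
  congr 1
  · simp
  · simp only [Matrix.transpose_zero, Matrix.mul_zero, zero_add, add_zero,
      Matrix.diagonal_transpose, Matrix.mul_neg, Matrix.mul_one, Matrix.neg_mul, hab]
  · simp only [Matrix.transpose_zero, Matrix.zero_mul, Matrix.mul_zero, zero_add, add_zero,
      Matrix.diagonal_transpose, Matrix.mul_one, mul_eq_one_comm.1 hab]
  · simp

theorem axisB_eq_div (h0 : ∀ i, 0 ≤ σ i) (h1 : ∀ i, σ i < 1) (i : Fin n) :
    axisB σ i = (Real.sqrt (1 - σ i ^ 2))⁻¹ * (1 - σ i) := by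
  have e1 : 0 < 1 - σ i := by linarith [h1 i]
  have e2 : 0 < 1 + σ i := by linarith [h0 i]
  have : 1 - σ i ^ 2 = (1 - σ i) * (1 + σ i) := by ring
  rw [axisB, this, Real.sqrt_div e1.le, Real.sqrt_mul e1.le]
  have := (Real.sqrt_pos.2 e1).ne'
  have := (Real.sqrt_pos.2 e2).ne'
  have := Real.sq_sqrt e1.le
  field_simp
  exact this

theorem axisA_eq_div (h0 : ∀ i, 0 ≤ σ i) (h1 : ∀ i, σ i < 1) (i : Fin n) :
    axisA σ i = (Real.sqrt (1 - σ i ^ 2))⁻¹ * (1 + σ i) := by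
  have e1 : 0 < 1 - σ i := by linarith [h1 i]
  have e2 : 0 < 1 + σ i := by linarith [h0 i]
  have : 1 - σ i ^ 2 = (1 - σ i) * (1 + σ i) := by ring
  rw [axisA, this, Real.sqrt_div e2.le, Real.sqrt_mul e1.le]
  have := (Real.sqrt_pos.2 e1).ne'
  have := (Real.sqrt_pos.2 e2).ne'
  have := Real.sq_sqrt e2.le
  field_simp
  exact this

/-- With `ζ = U*z` one has `U*Az̄ = Σζ̄`, so `z' = U(I - Σ²)^{-1/2}(ζ - Σζ̄)`. Real parts acquire
the factor `1 - σᵢ` and imaginary parts `1 + σᵢ`, each over `√(1 - σᵢ²)`. -/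
theorem toReal_zPrime (hA : A ∈ domain n) (h : IsSymmSVD A U σ) (z : Fin n → ℂ) :
    toReal (zPrime A z) = rotQ U *ᵥ (squeezeD σ *ᵥ ((rotQ U)ᵀ *ᵥ toReal z)) := by
  have h0 := h.2.1
  have h1 := h.sigma_lt_one hA
  have hUU : Uᴴ * U = 1 := Matrix.mem_unitaryGroup_iff'.1 h.1
  set ζ := Uᴴ *ᵥ z with hζ
  have hA1 : Uᴴ *ᵥ (A *ᵥ star z) = Matrix.diagonal (cvec σ) *ᵥ star ζ := by
    rw [hζ, Matrix.star_mulVec, Matrix.conjTranspose_conjTranspose, ← Matrix.mulVec_transpose,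
      Matrix.mulVec_mulVec, Matrix.mulVec_mulVec]
    conv_lhs => rw [h.2.2]
    rw [← Matrix.mul_assoc, ← Matrix.mul_assoc, hUU, Matrix.one_mul]
    rfl
  have hz : zPrime A z = U *ᵥ fun i =>
      (((Real.sqrt (1 - σ i ^ 2))⁻¹ : ℝ) : ℂ) * (ζ i - σ i * star (ζ i)) := by
    rw [zPrime, ← conjTranspose_eq_conjM hA.1, h.invSqrt_eq, conjDiagonal_apply,
      ← Matrix.mulVec_mulVec, ← Matrix.mulVec_mulVec, Matrix.mulVec_sub, hA1]
    congr 1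
    ext i
    simp [Matrix.mulVec_diagonal, cvec, hζ]
  rw [hz, toReal_mulVec, ← rotQ_conjTranspose, ← toReal_mulVec Uᴴ, ← hζ]
  congr 1
  ext i
  rw [squeezeD, Matrix.mulVec_diagonal]
  cases i with
  | inl i =>
    simp only [toReal, Sum.elim_inl, axisB_eq_div h0 h1 i, Complex.re_ofReal_mul, Complex.sub_re,
      RCLike.star_def, Complex.conj_re]
    ring
  | inr i =>
    simp only [toReal, Sum.elim_inr, axisA_eq_div h0 h1 i, Complex.im_ofReal_mul, Complex.sub_im,
      RCLike.star_def, Complex.conj_im]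
    ring

theorem sum_norm_sq_eq_toReal (z : Fin n → ℂ) : ∑ i, ‖z i‖ ^ 2 = toReal z ⬝ᵥ toReal z := by
  rw [toReal, sumElim_dotProduct_sumElim, dotProduct, dotProduct, ← Finset.sum_add_distrib]
  exact Finset.sum_congr rfl fun i _ => by rw [← Complex.normSq_eq_norm_sq, Complex.normSq_apply]

theorem sum_norm_sq_zPrime (hA : A ∈ domain n) (h : IsSymmSVD A U σ) {q p q' p' : Fin n → ℝ}
    (hq : Sum.elim q' p' = (rotQ U)ᵀ *ᵥ Sum.elim q p) :
    ∑ i, ‖zPrime A (toComplex q p) i‖ ^ 2 =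
      ∑ i, (q' i ^ 2 / axisA σ i ^ 2 + p' i ^ 2 / axisB σ i ^ 2) := by
  rw [sum_norm_sq_eq_toReal, toReal_zPrime hA h, toReal_toComplex, ← hq, Matrix.dotProduct_mulVec,
    ← Matrix.mulVec_transpose, Matrix.mulVec_mulVec,
    mul_eq_one_comm.1 (rotQ_mul_transpose h.1), Matrix.one_mulVec, dotProduct,
    Fintype.sum_sum_type, ← Finset.sum_add_distrib]
  refine Finset.sum_congr rfl fun i _ => ?_
  have ha := (axisA_pos h.2.1 (h.sigma_lt_one hA) i).ne'
  simp only [squeezeD, Matrix.mulVec_diagonal, Sum.elim_inl, Sum.elim_inr, axisB_eq_inv]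
  field_simp

end RealForm

/-! ### Squeezed states and their wave functions -/

variable {n : ℕ} {A : Matrix (Fin n) (Fin n) ℂ}

/-- The kernel integral is the Fock Gaussian with `α = 0`, `β = -A*`. Since `α = 0`, its value does
not depend on the source, hence not on `z`, and has modulus one; only `(det λ)^{-1/2}` contributes
to `‖k‖`. -/
theorem exists_squeezedState_eq (hA : A ∈ domain n) :
    ∃ k : ℂ, ‖k‖ ^ 4 = ‖(1 - A * conjM A).det‖ ∧
      ∀ z, squeezedState A z = k * Complex.exp ((1 / 2) * (z ⬝ᵥ (A *ᵥ z))) := by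
  obtain ⟨r, hr, hdet, hr2, hblock⟩ := iota_block_identities hA
  have hsym : (-Aᴴ)ᵀ = -Aᴴ := by
    rw [Matrix.transpose_neg, conjTranspose_eq_conjM hA.1, conjM, Matrix.transpose_map.symm, hA.1]
  have hpos : ∀ z : Fin n → ℂ, z ≠ 0 →
      0 < (2 * (z ⬝ᵥ star z) - z ⬝ᵥ ((0 : Matrix (Fin n) (Fin n) ℂ) *ᵥ z) -
        star z ⬝ᵥ (-Aᴴ *ᵥ star z)).re := by
    intro z hz
    have h1 := norm_dotProduct_mulVec_lt hA hz
    have h2 : star z ⬝ᵥ (Aᴴ *ᵥ star z) = star (z ⬝ᵥ (A *ᵥ z)) := by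
      rw [conjTranspose_eq_conjM hA.1, ← star_mulVec_conj, Matrix.star_dotProduct_star,
        dotProduct_comm]
    rw [dotProduct_star_self, Matrix.zero_mulVec, dotProduct_zero, Matrix.neg_mulVec,
      dotProduct_neg, h2]
    have h3 := Complex.abs_re_le_norm (z ⬝ᵥ (A *ᵥ z))
    have h4 := neg_abs_le (z ⬝ᵥ (A *ᵥ z)).re
    have h5 : (2 * (((‖WithLp.toLp 2 z‖ ^ 2 : ℝ)) : ℂ)).re = 2 * ‖WithLp.toLp 2 z‖ ^ 2 := by
      rw [Complex.mul_re, Complex.ofReal_re, Complex.ofReal_im]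
      simp
    rw [Complex.sub_re, Complex.sub_re, h5, Complex.neg_re, RCLike.star_def, Complex.conj_re,
      Complex.zero_re]
    nlinarith [norm_nonneg (z ⬝ᵥ (A *ᵥ z))]
  obtain ⟨c, hc, hint⟩ := exists_fock_gaussian Matrix.transpose_zero hsym hpos
  rw [Matrix.zero_mul, sub_zero, Matrix.det_one, norm_one, inv_one] at hc
  refine ⟨(r : ℂ) ^ (-(1 / 2) : ℂ) * c, ?_, fun z => ?_⟩
  · have h1 : (‖(r : ℂ) ^ (-(1 / 2) : ℂ)‖ ^ 4) = (r ^ 2)⁻¹ := by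
      rw [Complex.norm_cpow_eq_rpow_re_of_pos hr, ← Real.rpow_natCast, ← Real.rpow_mul hr.le,
        ← Real.rpow_natCast, ← Real.rpow_neg hr.le]
      norm_num
    rw [norm_mul, mul_pow, h1, show ‖c‖ ^ 4 = (‖c‖ ^ 2) ^ 2 by ring, hc, one_pow, mul_one]
    exact (eq_inv_of_mul_eq_one_right hr2).symm
  · have hu : IsUnit (invSqrt (1 - Aᴴ * A)).det := by
      rw [hdet]
      exact (Complex.ofReal_ne_zero.2 hr.ne').isUnit
    have hk : ∀ w, metaplecticKernel (iota A) z w * 1 =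
        ((r : ℂ) ^ (-(1 / 2) : ℂ) * Complex.exp ((1 / 2) * (z ⬝ᵥ (A *ᵥ z)))) *
          Complex.exp ((1 / 2) * (w ⬝ᵥ ((0 : Matrix (Fin n) (Fin n) ℂ) *ᵥ w)) +
            (1 / 2) * (star w ⬝ᵥ (-Aᴴ *ᵥ star w)) +
            ((invSqrt (1 - Aᴴ * A))⁻¹ *ᵥ z - -Aᴴ *ᵥ ((0 : Matrix (Fin n) (Fin n) ℂ) *ᵥ
              ((invSqrt (1 - Aᴴ * A))⁻¹ *ᵥ z))) ⬝ᵥ star w) := by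
      intro w
      rw [mul_one, metaplecticKernel, iota, Matrix.toBlocks_fromBlocks₁₁,
        Matrix.toBlocks_fromBlocks₁₂, Matrix.toBlocks_fromBlocks₂₁, hblock, hdet, Matrix.mul_assoc,
        Matrix.mul_nonsing_inv _ hu, Matrix.mul_one, mul_assoc, ← Complex.exp_add,
        Matrix.dotProduct_mulVec z (_)ᵀ, Matrix.vecMul_transpose]
      simp only [Matrix.zero_mulVec, Matrix.mulVec_zero, dotProduct_zero, sub_zero,
        Matrix.neg_mulVec, dotProduct_neg]
      congr 2
      ring
    rw [squeezedState, metaplectic]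
    simp only [hk]
    rw [integral_const_mul, hint]
    simp only [Matrix.zero_mulVec, dotProduct_zero, mul_zero, Complex.exp_zero]
    ring

/-- The matrix `(I - A)(I + A)⁻¹` of the Gaussian wave function. -/
noncomputable def waveMatrix (A : Matrix (Fin n) (Fin n) ℂ) : Matrix (Fin n) (Fin n) ℂ := 2 • (1 + A)⁻¹ - 1

theorem exists_invBargmann_squeezedState_eq (hA : A ∈ domain n) :
    ∃ κ : ℂ, ‖κ‖ ^ 4 = (π ^ n)⁻¹ * ‖(1 - A * conjM A).det‖ / ‖(1 + A).det‖ ^ 2 ∧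
      ∀ x, invBargmann (squeezedState A) x =
        κ * Complex.exp (-(1 / 2) * (cvec x ⬝ᵥ (waveMatrix A *ᵥ cvec x))) := by
  obtain ⟨k, hk, hstate⟩ := exists_squeezedState_eq hA
  have hpos : ∀ z : Fin n → ℂ, z ≠ 0 →
      0 < (2 * (z ⬝ᵥ star z) - z ⬝ᵥ (A *ᵥ z) -
        star z ⬝ᵥ ((-1 : Matrix (Fin n) (Fin n) ℂ) *ᵥ star z)).re := by
    intro z hz
    have h1 := norm_dotProduct_mulVec_lt hA hz
    have h2 := norm_dotProduct_le (star z) (star z)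
    rw [norm_toLp_star] at h2
    have h3 := (Complex.re_le_norm (z ⬝ᵥ (A *ᵥ z)))
    have h4 := (neg_abs_le (star z ⬝ᵥ star z).re)
    have h4' := Complex.abs_re_le_norm (star z ⬝ᵥ star z)
    have h5 : (2 * (((‖WithLp.toLp 2 z‖ ^ 2 : ℝ)) : ℂ)).re = 2 * ‖WithLp.toLp 2 z‖ ^ 2 := by
      rw [Complex.mul_re, Complex.ofReal_re, Complex.ofReal_im]
      simp
    rw [dotProduct_star_self, Matrix.neg_mulVec, Matrix.one_mulVec, dotProduct_neg,
      Complex.sub_re, Complex.sub_re, h5, Complex.neg_re]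
    nlinarith
  obtain ⟨c, hc, hint⟩ := exists_fock_gaussian hA.1
    (by rw [Matrix.transpose_neg, Matrix.transpose_one]) hpos
  rw [Matrix.mul_neg, Matrix.mul_one, sub_neg_eq_add] at hc
  have hE : IsUnit (1 + A).det := (det_one_add_ne_zero hA).isUnit
  refine ⟨((π ^ (-(n : ℝ) / 4) : ℝ) : ℂ) * k * c, ?_, fun x => ?_⟩
  · have h1 : (π ^ (-(n : ℝ) / 4)) ^ 4 = (π ^ n)⁻¹ := by
      rw [← Real.rpow_natCast, ← Real.rpow_mul Real.pi_pos.le, ← Real.rpow_natCast,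
        ← Real.rpow_neg Real.pi_pos.le]
      congr 1
      push_cast
      ring
    rw [norm_mul, norm_mul, mul_pow, mul_pow, hk, Complex.norm_real,
      Real.norm_of_nonneg (by positivity), h1, show ‖c‖ ^ 4 = (‖c‖ ^ 2) ^ 2 by ring, hc, inv_pow,
      div_eq_mul_inv]
  -- Here `α = A` and `β = -1`, so the source `s - βαs = (1 + A)s` has to equal `√2 x`.
  · set s := (1 + A)⁻¹ *ᵥ ((Real.sqrt 2 : ℂ) • cvec x) with hs
    have hs1 : s + A *ᵥ s = (Real.sqrt 2 : ℂ) • cvec x := by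
      have : s + A *ᵥ s = (1 + A) *ᵥ s := by rw [Matrix.add_mulVec, Matrix.one_mulVec]
      rw [this, hs, Matrix.mulVec_mulVec, Matrix.mul_nonsing_inv _ hE, Matrix.one_mulVec]
    have hs2 : s - (-1 : Matrix (Fin n) (Fin n) ℂ) *ᵥ (A *ᵥ s) = (Real.sqrt 2 : ℂ) • cvec x := by
      rw [Matrix.neg_mulVec, Matrix.one_mulVec, sub_neg_eq_add, hs1]
    have hint' := hint s
    rw [hs2] at hint'
    have hbody : ∀ z : Fin n → ℂ, Complex.exp (-(star z ⬝ᵥ star z) / 2 + (Real.sqrt 2 : ℂ) *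
        (star z ⬝ᵥ (fun i => (x i : ℂ)))) * squeezedState A z =
        k * Complex.exp ((1 / 2) * (z ⬝ᵥ (A *ᵥ z)) + (1 / 2) *
          (star z ⬝ᵥ ((-1 : Matrix (Fin n) (Fin n) ℂ) *ᵥ star z)) +
          ((Real.sqrt 2 : ℂ) • cvec x) ⬝ᵥ star z) := by
      intro z
      rw [hstate, mul_left_comm, ← Complex.exp_add, Matrix.neg_mulVec, Matrix.one_mulVec,
        dotProduct_neg, smul_dotProduct, dotProduct_comm (cvec x), smul_eq_mul]
      congr 2
      rw [show (fun i => (x i : ℂ)) = cvec x from rfl]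
      ring
    have hx : ((x ⬝ᵥ x : ℝ) : ℂ) = cvec x ⬝ᵥ cvec x := by
      simp [dotProduct, cvec]
    have h2 : (Real.sqrt 2 : ℂ) * (Real.sqrt 2 : ℂ) = 2 := by
      rw [← Complex.ofReal_mul, Real.mul_self_sqrt zero_le_two, Complex.ofReal_ofNat]
    rw [invBargmann]
    simp only [hbody]
    rw [integral_const_mul, hint', Complex.ofReal_mul, Complex.ofReal_exp]
    have hexp : Complex.exp (((-(x ⬝ᵥ x) / 2 : ℝ)) : ℂ) *
        Complex.exp (1 / 2 * (((Real.sqrt 2 : ℂ) • cvec x) ⬝ᵥ (A *ᵥ s))) =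
        Complex.exp (-(1 / 2) * (cvec x ⬝ᵥ (waveMatrix A *ᵥ cvec x))) := by
      rw [← Complex.exp_add]
      congr 1
      rw [eq_sub_of_add_eq' hs1, hs, waveMatrix, Matrix.sub_mulVec, Matrix.one_mulVec,
        Matrix.smul_mulVec, Matrix.mulVec_smul, ← smul_sub, smul_dotProduct, dotProduct_smul,
        dotProduct_sub, dotProduct_sub, dotProduct_smul, Complex.ofReal_div, Complex.ofReal_neg, hx,
        smul_eq_mul, smul_eq_mul, ← mul_assoc (Real.sqrt 2 : ℂ), h2, nsmul_eq_mul]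
      push_cast
      ring
    rw [← hexp]
    ring

/-! ### The Wigner distribution of a Gaussian -/

theorem wigner_gaussian {B : Matrix (Fin n) (Fin n) ℂ} (hB : Bᵀ = B) {κ : ℂ}
    {ψ : (Fin n → ℝ) → ℂ}
    (hψ : ∀ x, ψ x = κ * Complex.exp (-(1 / 2) * (cvec x ⬝ᵥ (B *ᵥ cvec x))))
    (hpos : ∀ v : Fin n → ℝ, v ≠ 0 → 0 < (cvec v ⬝ᵥ ((B + conjM B) *ᵥ cvec v)).re)
    (q p : Fin n → ℝ) {u : Fin n → ℂ}
    (hu : (B + conjM B) *ᵥ u = B *ᵥ cvec q - conjM B *ᵥ cvec q + (2 * Complex.I) • cvec p) :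
    wigner ψ q p = ((π ^ n)⁻¹ : ℝ) * ((‖κ‖ ^ 2 : ℝ) * gaussInt (B + conjM B) *
      Complex.exp ((1 / 2) * (u ⬝ᵥ ((B + conjM B) *ᵥ u)) -
        (1 / 2) * (cvec q ⬝ᵥ ((B + conjM B) *ᵥ cvec q)))) := by
  have hBc : (conjM B)ᵀ = conjM B := by rw [conjM, Matrix.transpose_map.symm, hB]
  have hcomm : ∀ (M : Matrix (Fin n) (Fin n) ℂ), Mᵀ = M → ∀ v w : Fin n → ℂ,
      v ⬝ᵥ (M *ᵥ w) = (M *ᵥ v) ⬝ᵥ w := by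
    intro M hM v w
    rw [Matrix.dotProduct_mulVec, ← Matrix.mulVec_transpose, hM]
  have hsym : (B + conjM B)ᵀ = B + conjM B := by rw [Matrix.transpose_add, hB, hBc]
  have hstar : ∀ x, star (ψ x) =
      star κ * Complex.exp (-(1 / 2) * (cvec x ⬝ᵥ (conjM B *ᵥ cvec x))) := by
    intro x
    have hx : star (cvec x) = cvec x := by ext i; simp [cvec]
    have h1 : star (cvec x ⬝ᵥ (B *ᵥ cvec x)) = cvec x ⬝ᵥ (conjM B *ᵥ cvec x) := by
      rw [← Matrix.star_dotProduct_star, star_mulVec_conj, hx, dotProduct_comm]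
    rw [hψ, star_mul', ← h1, RCLike.star_def, ← Complex.exp_conj]
    simp [Complex.conj_ofNat]
  have hroyer : ∀ y, grossmannRoyer q p ψ (y + q) =
      Complex.exp (2 * Complex.I * (cvec p ⬝ᵥ cvec y)) * ψ (q - y) := by
    intro y
    have hy : -(y + q - q) - -q = q - y := by abel
    rw [grossmannRoyer, heisenbergWeyl, parity, heisenbergWeyl, hy, ← mul_assoc, ← Complex.exp_add]
    congr 2
    have hp : cvec p ⬝ᵥ cvec y = ((p ⬝ᵥ y : ℝ) : ℂ) := by simp [dotProduct, cvec]
    rw [hp]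
    simp only [add_sub_cancel_right, neg_dotProduct, dotProduct_neg, dotProduct_add, neg_neg]
    push_cast
    ring
  have hint : ∀ y, grossmannRoyer q p ψ (y + q) * star (ψ (y + q)) =
      (‖κ‖ ^ 2 : ℝ) * Complex.exp (-(1 / 2) * (cvec q ⬝ᵥ ((B + conjM B) *ᵥ cvec q))) *
        Complex.exp (-(1 / 2) * (cvec y ⬝ᵥ ((B + conjM B) *ᵥ cvec y)) +
          ((B + conjM B) *ᵥ u) ⬝ᵥ cvec y) := by
    intro y
    have hκ : ((‖κ‖ ^ 2 : ℝ) : ℂ) = κ * star κ := by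
      rw [RCLike.star_def, Complex.mul_conj, Complex.normSq_eq_norm_sq]
    have e1 : cvec (q - y) = cvec q - cvec y := by ext i; simp [cvec]
    have e2 : cvec (y + q) = cvec y + cvec q := by ext i; simp [cvec]
    have e3 : cvec y ⬝ᵥ (B *ᵥ cvec q) = (B *ᵥ cvec q) ⬝ᵥ cvec y := dotProduct_comm _ _
    have e4 : cvec y ⬝ᵥ (conjM B *ᵥ cvec q) = (conjM B *ᵥ cvec q) ⬝ᵥ cvec y := dotProduct_comm _ _
    rw [hroyer, hstar, hψ, hκ, hu, e1, e2]
    have : ∀ a b c : ℂ, Complex.exp a * (κ * Complex.exp b) * (star κ * Complex.exp c) =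
        κ * star κ * Complex.exp (a + b + c) := by
      intro a b c
      rw [Complex.exp_add, Complex.exp_add]
      ring
    rw [this, mul_assoc (κ * star κ), ← Complex.exp_add]
    congr 2
    simp only [Matrix.mulVec_sub, Matrix.mulVec_add, Matrix.add_mulVec, dotProduct_add,
      dotProduct_sub, sub_dotProduct, add_dotProduct, smul_dotProduct, smul_eq_mul, e3, e4,
      hcomm B hB (cvec q) (cvec y), hcomm _ hBc (cvec q) (cvec y)]
    ring
  -- Centring at `q` puts the two factors at `q - y` and `q + y`, so the quadratic part in `y`
  -- becomes `B + B̄`.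
  rw [wigner, ← integral_add_right_eq_self _ q]
  simp only [hint]
  rw [integral_const_mul, (norm_sq_gaussInt hsym hpos).2 u, sub_eq_add_neg, Complex.exp_add,
    neg_mul]
  ring

theorem conjM_one : conjM (1 : Matrix (Fin n) (Fin n) ℂ) = 1 := by
  ext i j
  by_cases hij : i = j <;> simp [conjM, Matrix.one_apply, hij]

theorem conjM_add (A B : Matrix (Fin n) (Fin n) ℂ) : conjM (A + B) = conjM A + conjM B := by
  ext i j
  simp [conjM]

theorem det_conjM (A : Matrix (Fin n) (Fin n) ℂ) : (conjM A).det = star A.det :=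
  (RingHom.map_det (starRingEnd ℂ) A).symm

theorem conjM_inv {A : Matrix (Fin n) (Fin n) ℂ} (hA : IsUnit A.det) :
    conjM A⁻¹ = (conjM A)⁻¹ := by
  refine (Matrix.inv_eq_right_inv ?_).symm
  rw [← conjM_mul, Matrix.mul_nonsing_inv _ hA, conjM_one]

theorem star_cvec {ι : Type*} (v : ι → ℝ) : star (cvec v) = cvec v := by
  ext i
  simp [cvec]

theorem conjM_waveMatrix (hA : A ∈ domain n) :
    conjM (waveMatrix A) = 2 • (1 + conjM A)⁻¹ - 1 := by
  have e : (1 + conjM A)⁻¹ = conjM (1 + A)⁻¹ := by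
    rw [conjM_inv (det_one_add_ne_zero hA).isUnit, conjM_add, conjM_one]
  rw [e, waveMatrix, two_smul, two_smul]
  ext i j
  by_cases hij : i = j <;> simp [conjM, hij]

theorem isUnit_det_one_add_conjM (hA : A ∈ domain n) : IsUnit (1 + conjM A).det := by
  rw [← conjM_one, ← conjM_add, det_conjM]
  exact (star_ne_zero.2 (det_one_add_ne_zero hA)).isUnit

theorem transpose_waveMatrix (hA : Aᵀ = A) : (waveMatrix A)ᵀ = waveMatrix A := by
  rw [waveMatrix, Matrix.transpose_sub, Matrix.transpose_smul, Matrix.transpose_nonsing_inv,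
    Matrix.transpose_add, Matrix.transpose_one, hA]

theorem waveMatrix_add_conjM (hA : A ∈ domain n) :
    waveMatrix A + conjM (waveMatrix A) =
      2 • ((1 + A)⁻¹ * (1 - A * conjM A) * (1 + conjM A)⁻¹) := by
  have h1 : (1 + A)⁻¹ * (1 + A) = 1 :=
    Matrix.nonsing_inv_mul _ (det_one_add_ne_zero hA).isUnit
  have h2 : (1 + conjM A) * (1 + conjM A)⁻¹ = 1 :=
    Matrix.mul_nonsing_inv _ (isUnit_det_one_add_conjM hA)
  -- Multiplying by `(1 + A)⁻¹` on the left and `(1 + Ā)⁻¹` on the right turns this into a sum of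
  -- inverses minus `1`.
  have key : (1 - A * conjM A) = (1 + A) + (1 + conjM A) - (1 + A) * (1 + conjM A) := by
    noncomm_ring
  have e : (1 + A)⁻¹ * (1 - A * conjM A) * (1 + conjM A)⁻¹ =
      (1 + A)⁻¹ * (1 + A) * (1 + conjM A)⁻¹ + (1 + A)⁻¹ * ((1 + conjM A) * (1 + conjM A)⁻¹) -
        (1 + A)⁻¹ * (1 + A) * ((1 + conjM A) * (1 + conjM A)⁻¹) := by
    rw [key]
    noncomm_ring
  rw [e, h1, h2, conjM_waveMatrix hA, waveMatrix]
  noncomm_ring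

/-- With `w = (1 + Ā)⁻¹v` the form equals `2(|w|² - |Aw̄|²)`, positive because `‖A‖ < 1`. -/
theorem re_waveMatrix_pos (hA : A ∈ domain n) {v : Fin n → ℝ} (hv : v ≠ 0) :
    0 < (cvec v ⬝ᵥ ((waveMatrix A + conjM (waveMatrix A)) *ᵥ cvec v)).re := by
  have hu := isUnit_det_one_add_conjM hA
  set w := (1 + conjM A)⁻¹ *ᵥ cvec v with hw
  clear_value w
  have hv' : cvec v = (1 + conjM A) *ᵥ w := by
    rw [hw, Matrix.mulVec_mulVec, Matrix.mul_nonsing_inv _ hu, Matrix.one_mulVec]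
  have hw0 : w ≠ 0 := by
    intro h0
    rw [h0, Matrix.mulVec_zero] at hv'
    refine hv (funext fun i => ?_)
    have := congrFun hv' i
    simpa [cvec] using this
  have hE : cvec v ᵥ* (1 + A)⁻¹ = star w := by
    have hT : ((1 + A)⁻¹)ᵀ = (1 + A)⁻¹ := by
      rw [Matrix.transpose_nonsing_inv, Matrix.transpose_add, Matrix.transpose_one, hA.1]
    rw [← Matrix.mulVec_transpose, hT, hw, star_mulVec_conj, star_cvec,
      conjM_inv hu, conjM_add, conjM_one, conjM_conjM]
  have hC : star (conjM A *ᵥ w) = A *ᵥ star w := by rw [star_mulVec_conj, conjM_conjM]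
  have hval : cvec v ⬝ᵥ ((waveMatrix A + conjM (waveMatrix A)) *ᵥ cvec v) =
      2 * ((‖WithLp.toLp 2 w‖ ^ 2 - ‖WithLp.toLp 2 (A *ᵥ star w)‖ ^ 2 : ℝ) : ℂ) := by
    rw [waveMatrix_add_conjM hA, Matrix.smul_mulVec, dotProduct_smul, ← Matrix.mulVec_mulVec, ← hw,
      ← Matrix.mulVec_mulVec, Matrix.dotProduct_mulVec, hE, Matrix.sub_mulVec, Matrix.one_mulVec,
      dotProduct_sub, ← Matrix.mulVec_mulVec, Matrix.dotProduct_mulVec (star w) A,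
      ← Matrix.mulVec_transpose, hA.1, ← hC, dotProduct_comm (star w),
      dotProduct_comm (star (conjM A *ᵥ w)), dotProduct_star_self, dotProduct_star_self,
      norm_toLp_star, nsmul_eq_mul]
    push_cast
    ring
  have hlt := norm_mulVec_lt hA (star_ne_zero.2 hw0)
  rw [norm_toLp_star] at hlt
  rw [hval, Complex.mul_re, Complex.ofReal_re, Complex.ofReal_im, Complex.re_ofNat]
  nlinarith [norm_nonneg (WithLp.toLp 2 (A *ᵥ star w))]

theorem exists_gaussInt_eq_ofReal {M : Matrix (Fin n) (Fin n) ℂ} (hM : conjM M = M) :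
    ∃ g : ℝ, 0 ≤ g ∧ gaussInt M = g := by
  have hreal : ∀ v : Fin n → ℝ, cvec v ⬝ᵥ (M *ᵥ cvec v) =
      ((cvec v ⬝ᵥ (M *ᵥ cvec v)).re : ℂ) := by
    intro v
    refine (Complex.conj_eq_iff_re.1 ?_).symm
    rw [← RCLike.star_def, ← Matrix.star_dotProduct_star, star_mulVec_conj, star_cvec, hM,
      dotProduct_comm]
  refine ⟨∫ v : Fin n → ℝ, Real.exp (-(1 / 2) * (cvec v ⬝ᵥ (M *ᵥ cvec v)).re),
    integral_nonneg fun v => (Real.exp_pos _).le, ?_⟩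
  rw [gaussInt]
  refine Eq.trans ?_ (integral_ofReal (𝕜 := ℂ))
  refine integral_congr_ae (Filter.Eventually.of_forall fun v => ?_)
  simp only
  rw [hreal v, Complex.ofReal_re]
  refine Eq.trans ?_ (Complex.ofReal_exp _).symm
  push_cast
  rfl

theorem wignerFock_squeezedState (hA : A ∈ domain n) (q p : Fin n → ℝ) :
    wignerFock (squeezedState A) q p =
      (((π ^ n)⁻¹ * Real.exp (-∑ i, ‖zPrime A (toComplex q p) i‖ ^ 2) : ℝ) : ℂ) := by
  obtain ⟨κ, hκ, hψ⟩ := exists_invBargmann_squeezedState_eq hA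
  obtain ⟨U, σ, hSVD⟩ := exists_isSymmSVD hA.1
  have hAH := conjTranspose_eq_conjM hA.1
  have hF := (det_one_add_ne_zero hA).isUnit
  have hF' := isUnit_det_one_add_conjM hA
  set X := invSqrt (1 - A * conjM A) with hX
  have hX1 : X * X * (1 - A * conjM A) = 1 := by
    rw [hX, ← hAH]
    exact hSVD.invSqrt_mul_self hA
  have hXH : Xᴴ = X := by
    rw [hX, ← hAH]
    exact hSVD.invSqrt_isHermitian
  set B := waveMatrix A with hB
  set M := B + conjM B with hM
  have hMeq : M = 2 • ((1 + A)⁻¹ * (1 - A * conjM A) * (1 + conjM A)⁻¹) := waveMatrix_add_conjM hA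
  have hpos : ∀ v : Fin n → ℝ, v ≠ 0 → 0 < (cvec v ⬝ᵥ (M *ᵥ cvec v)).re :=
    fun v hv => re_waveMatrix_pos hA hv
  have hBT : Bᵀ = B := transpose_waveMatrix hA.1
  have hMT : Mᵀ = M := by
    rw [hM, Matrix.transpose_add, hBT, conjM, Matrix.transpose_map.symm, hBT]
  -- The moduli of `κ` and of the integral give the square of this product; nonnegativity of the
  -- integral then fixes the sign.
  have hnorm : ((‖κ‖ ^ 2 : ℝ) : ℂ) * gaussInt M = 1 := by
    obtain ⟨g, hg0, hg⟩ := exists_gaussInt_eq_ofReal (M := M)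
      (by rw [hM, conjM_add, conjM_conjM, add_comm])
    have hg2 := (norm_sq_gaussInt hMT hpos).1
    have hdet : ‖M.det‖ = 2 ^ n * ‖(1 - A * conjM A).det‖ / ‖(1 + A).det‖ ^ 2 := by
      have h1 : ‖((1 + A)⁻¹).det‖ = ‖(1 + A).det‖⁻¹ := by
        rw [Matrix.det_nonsing_inv, Ring.inverse_eq_inv', norm_inv]
      have e : (1 + conjM A).det = star (1 + A).det := by
        rw [← det_conjM, conjM_add, conjM_one]
      have h2 : ‖((1 + conjM A)⁻¹).det‖ = ‖(1 + A).det‖⁻¹ := by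
        rw [Matrix.det_nonsing_inv, Ring.inverse_eq_inv', norm_inv, e, norm_star]
      have h3 : M = (2 : ℂ) • ((1 + A)⁻¹ * (1 - A * conjM A) * (1 + conjM A)⁻¹) := by
        rw [hMeq, two_smul, two_smul]
      rw [h3, Matrix.det_smul, Matrix.det_mul, Matrix.det_mul, norm_mul, norm_mul, norm_mul, h1, h2,
        norm_pow, Fintype.card_fin, Complex.norm_ofNat]
      ring
    have hD : 0 < ‖(1 - A * conjM A).det‖ := by
      have := congrArg Matrix.det hX1
      rw [Matrix.det_mul, Matrix.det_one] at this
      exact norm_pos_iff.2 (right_ne_zero_of_mul_eq_one this)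
    have hd : 0 < ‖(1 + A).det‖ := norm_pos_iff.2 (det_one_add_ne_zero hA)
    rw [hg, Complex.norm_real, Real.norm_of_nonneg hg0, hdet, Fintype.card_fin, mul_pow] at hg2
    have hsq : (‖κ‖ ^ 2 * g) ^ 2 = 1 := by
      rw [mul_pow, ← pow_mul, hκ, hg2]
      field_simp
    have h1 : ‖κ‖ ^ 2 * g = 1 := by
      have h0 : 0 ≤ ‖κ‖ ^ 2 * g := by positivity
      exact (pow_eq_one_iff_of_nonneg h0 two_ne_zero).1 hsq
    rw [hg, ← Complex.ofReal_mul, h1, Complex.ofReal_one]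
  -- `N` is `2M⁻¹`, and it equals `(X(1 + A))*(X(1 + A))`; this produces the squared norm at the
  -- end.
  set N := (1 + conjM A) * (X * X) * (1 + A) with hN
  have hX2 : (1 - A * conjM A) * (X * X) = 1 := mul_eq_one_comm.1 hX1
  have hMN : M * N = 2 • 1 := by
    have e : M * N = 2 • ((1 + A)⁻¹ * ((1 - A * conjM A) *
        ((1 + conjM A)⁻¹ * (1 + conjM A)) * (X * X)) * (1 + A)) := by
      rw [hMeq, hN, Matrix.smul_mul]
      simp only [Matrix.mul_assoc]
    rw [e, Matrix.nonsing_inv_mul _ hF', Matrix.mul_one, hX2, Matrix.mul_one,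
      Matrix.nonsing_inv_mul _ hF]
  set y := B *ᵥ cvec q + Complex.I • cvec p with hy
  clear_value y
  have hystar : star y = conjM B *ᵥ cvec q - Complex.I • cvec p := by
    rw [hy, star_add, star_mulVec_conj, star_smul, star_cvec, star_cvec, RCLike.star_def,
      Complex.conj_I, neg_smul, sub_eq_add_neg]
  have hyy : M *ᵥ cvec q = y + star y := by
    rw [hystar, hy, hM, Matrix.add_mulVec]
    abel
  have hMNy : M *ᵥ (N *ᵥ y) = (2 : ℂ) • y := by
    rw [Matrix.mulVec_mulVec, hMN, Matrix.smul_mulVec, Matrix.one_mulVec, two_smul,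
      two_smul]
  -- The critical point is `u = Ny - q`, since `MNy = 2y` and `Mq = y + ȳ`.
  have hMu : M *ᵥ (N *ᵥ y - cvec q) = y - star y := by
    rw [Matrix.mulVec_sub, hMNy, hyy, two_smul]
    abel
  have hu : M *ᵥ (N *ᵥ y - cvec q) =
      B *ᵥ cvec q - conjM B *ᵥ cvec q + (2 * Complex.I) • cvec p := by
    rw [hMu, hystar, hy, mul_smul, two_smul]
    abel
  have hMsymm : ∀ v w : Fin n → ℂ, v ⬝ᵥ (M *ᵥ w) = (M *ᵥ v) ⬝ᵥ w := by
    intro v w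
    rw [Matrix.dotProduct_mulVec, ← Matrix.mulVec_transpose, hMT]
  have hexp : (1 / 2) * ((N *ᵥ y - cvec q) ⬝ᵥ (M *ᵥ (N *ᵥ y - cvec q))) -
      (1 / 2) * (cvec q ⬝ᵥ (M *ᵥ cvec q)) = -(star y ⬝ᵥ (N *ᵥ y)) := by
    have h1 : cvec q ⬝ᵥ ((2 : ℂ) • y) = (y + star y) ⬝ᵥ (N *ᵥ y) := by
      rw [← hMNy, hMsymm, hyy]
    rw [dotProduct_smul, add_dotProduct, smul_eq_mul] at h1
    rw [hMu, hyy, sub_dotProduct, dotProduct_sub, dotProduct_sub, dotProduct_add,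
      dotProduct_comm (N *ᵥ y), dotProduct_comm (N *ᵥ y)]
    linear_combination (-1 / 2) * h1
  have hg : (1 + A) *ᵥ y = toComplex q p - A *ᵥ star (toComplex q p) := by
    have hz : toComplex q p = cvec q + Complex.I • cvec p := by
      ext i
      simp [toComplex, cvec]
    have hFB : (1 + A) * B = 1 - A := by
      rw [hB, waveMatrix, Matrix.mul_sub, Matrix.mul_smul, Matrix.mul_nonsing_inv _ hF,
        Matrix.mul_one]
      noncomm_ring
    rw [hz, hy, Matrix.mulVec_add, Matrix.mulVec_mulVec, hFB, star_add, star_smul, star_cvec,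
      star_cvec, RCLike.star_def, Complex.conj_I, Matrix.mulVec_add, Matrix.mulVec_smul,
      Matrix.mulVec_smul, Matrix.sub_mulVec, Matrix.add_mulVec, Matrix.one_mulVec,
      Matrix.one_mulVec, smul_add, neg_smul]
    abel
  have hquad : star y ⬝ᵥ (N *ᵥ y) = ((∑ i, ‖zPrime A (toComplex q p) i‖ ^ 2 : ℝ) : ℂ) := by
    have hz : zPrime A (toComplex q p) = (X * (1 + A)) *ᵥ y := by
      rw [← Matrix.mulVec_mulVec, hg, zPrime]
    have hH : (X * (1 + A))ᴴ = (1 + conjM A) * X := by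
      rw [Matrix.conjTranspose_mul, hXH, Matrix.conjTranspose_add, Matrix.conjTranspose_one, hAH]
    have hNe : N = (X * (1 + A))ᴴ * (X * (1 + A)) := by
      rw [hH, hN]
      simp only [Matrix.mul_assoc]
    have hn := EuclideanSpace.norm_sq_eq (WithLp.toLp 2 (zPrime A (toComplex q p)))
    rw [hNe, ← Matrix.mulVec_mulVec, Matrix.dotProduct_mulVec, ← Matrix.star_mulVec, ← hz,
      dotProduct_comm, dotProduct_star_self, hn]
  rw [wignerFock, wigner_gaussian hBT hψ hpos q p hu, hnorm, one_mul, hexp, hquad]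
  push_cast
  rfl

end Squeezed

theorem mainTheorem9 (n : ℕ) (A : Matrix (Fin n) (Fin n) ℂ) (hA : A ∈ Squeezed.domain n) :
    (∀ q p : Fin n → ℝ,
      Squeezed.wignerFock (Squeezed.squeezedState A) q p =
        (((π ^ n)⁻¹ *
          Real.exp (-∑ i, ‖Squeezed.zPrime A (Squeezed.toComplex q p) i‖ ^ 2) : ℝ) : ℂ)) ∧
    (∃ (U : Matrix (Fin n) (Fin n) ℂ) (σ : Fin n → ℝ), Squeezed.IsSymmSVD A U σ) ∧
    (∀ (U : Matrix (Fin n) (Fin n) ℂ) (σ : Fin n → ℝ), Squeezed.IsSymmSVD A U σ →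
      (∀ i, σ i < 1 ∧ 0 < Squeezed.axisA σ i ∧
        Squeezed.axisB σ i = (Squeezed.axisA σ i)⁻¹) ∧
      Squeezed.rotQ U ∈ Matrix.orthogonalGroup (Fin n ⊕ Fin n) ℝ ∧
      Squeezed.rotQ U ∈ Matrix.symplecticGroup (Fin n) ℝ ∧
      Squeezed.squeezeD σ ∈ Matrix.symplecticGroup (Fin n) ℝ ∧
      (∀ q p : Fin n → ℝ,
        Squeezed.toReal (Squeezed.zPrime A (Squeezed.toComplex q p)) =
          (Squeezed.rotQ U * Squeezed.squeezeD σ * (Squeezed.rotQ U)⁻¹) *ᵥ Sum.elim q p) ∧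
      (∀ q p q' p' : Fin n → ℝ,
        Sum.elim q' p' = (Squeezed.rotQ U)ᵀ *ᵥ Sum.elim q p →
        Squeezed.wignerFock (Squeezed.squeezedState A) q p =
          (((π ^ n)⁻¹ *
            Real.exp (-∑ i, (q' i ^ 2 / Squeezed.axisA σ i ^ 2 +
              p' i ^ 2 / Squeezed.axisB σ i ^ 2)) : ℝ) : ℂ))) := by
  refine ⟨Squeezed.wignerFock_squeezedState hA, Squeezed.exists_isSymmSVD hA.1,
    fun U σ h => ?_⟩
  have h1 := h.sigma_lt_one hA
  have hQ := Squeezed.rotQ_mul_transpose h.1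
  refine ⟨fun i => ⟨h1 i, Squeezed.axisA_pos h.2.1 h1 i, Squeezed.axisB_eq_inv σ i⟩,
    (Matrix.mem_orthogonalGroup_iff _ _).2 hQ, Squeezed.rotQ_mem_symplecticGroup h.1,
    Squeezed.squeezeD_mem_symplecticGroup h.2.1 h1, fun q p => ?_, fun q p q' p' hq => ?_⟩
  · rw [Squeezed.toReal_zPrime hA h, Squeezed.toReal_toComplex, Matrix.inv_eq_right_inv hQ,
      Matrix.mulVec_mulVec, Matrix.mulVec_mulVec]
  · rw [Squeezed.wignerFock_squeezedState hA, Squeezed.sum_norm_sq_zPrime hA h hq]
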